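/- All Hilbert spaces are finite-dimensional and $S(\rho)=-\mathrm{tr}[\rho\log_2\rho]$ is the von Neumann entropy. For a channel (completely positive trace preserving linear map) $\Psi$ and a finite ensemble $\{p_i,\rho_i\}$ of input states put $$\chi_{\rm assist}(\Psi,\{p_i,\rho_i\})=\sum_i p_iS(\rho_i)+S\Big(\Psi\Big(\sum_i p_i\rho_i\Big)\Big)-\sum_i p_iS\big((\Psi\otimes\mathcal I)(\phi_i)\big),$$ where $\phi_i$ is a purification of $\rho_i$ (the value does not depend on its choice), and for $P\ge 0$ let $$\mathcal C^{(1)}_P(\Psi)=\max\Big\{\chi_{\rm assist}(\Psi,\{p_i,\rho_i\}) : \{p_i,\rho_i\}\text{ a finite ensemble with }\sum_i p_iS(\rho_i)\le P\Big\}$$ be the one-shot classical capacity with entanglement assistance $P$. Lemma. Let $\Psi$ be a channel with (nonzero) input space $\mathcal H_R\otimes\mathcal H_C$, let $\{|j\rangle\}$ be an orthonormal basis of $\mathcal H_R$ and $\Pi(\rho)=\sum_j|j\rangle\langle j|\rho|j\rangle\langle j|$, and suppose $\Psi=\Psi\circ(\Pi\otimes\mathcal I_C)$. Then: (1) for every $P\ge0$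 the maximum defining $\mathcal C^{(1)}_P(\Psi)$ exists, and it is attained by a finite ensemble of the form $\{p_{ij},|j\rangle\langle j|\otimes\rho_{ij}\}$, where the $\rho_{ij}$ are states of $C$ and $\sum_{ij}p_{ij}S(|j\rangle\langle j|\otimes\rho_{ij})\le P$; (2) for every finite ensemble $\{q_i,\sigma_i\}$ of states of $R\otimes C$ there is a finite ensemble $\{p_{ij},|j\rangle\langle j|\otimes\rho_{ij}\}$ of this form with $$\sum_{ij}p_{ij}S(|j\rangle\langle j|\otimes\rho_{ij})\le\sum_i q_iS(\sigma_i)\quad\text{and}\quad \chi_{\rm assist}(\Psi,\{p_{ij},|j\rangle\langle j|\otimes\rho_{ij}\})\ge\chi_{\rm assist}(\Psi,\{q_i,\sigma_i\}).$$ -/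

import Mathlib

open scoped ComplexOrder Kronecker

namespace LimitedEA

section Basic

variable {A B E ι : Type*}

/-- A (mixed) quantum state: a positive semidefinite matrix of trace one. -/
def IsState [Fintype A] (ρ : Matrix A A ℂ) : Prop :=
  ρ.PosSemidef ∧ ρ.trace = 1

/-- The von Neumann entropy `S(ρ) = -tr[ρ log ρ]`, in bits, for Hermitian `ρ`
(the value on other matrices is irrelevant). -/
noncomputable def entropy [Fintype A] [DecidableEq A] (ρ : Matrix A A ℂ) : ℝ :=
  open Classical in
  if h : ρ.IsHermitian then (∑ a, Real.negMulLog (h.eigenvalues a)) / Real.log 2 else 0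

/-- The rank-one matrix `|ψ⟩⟨ψ|`. -/
def ketBra (ψ : A → ℂ) : Matrix A A ℂ :=
  Matrix.vecMulVec ψ (star ψ)

/-- The partial trace `tr_E` of an operator on `A ⊗ E`. -/
def partialTrace [Fintype E] (X : Matrix (A × E) (A × E) ℂ) : Matrix A A ℂ :=
  Matrix.of fun a a' => ∑ e, X (a, e) (a', e)

/-- The map `Ψ ⊗ I_E` on operators on `A ⊗ E`, acting blockwise. -/
def tensorId (Ψ : Matrix A A ℂ →ₗ[ℂ] Matrix B B ℂ) (E : Type*) :
    Matrix (A × E) (A × E) ℂ →ₗ[ℂ] Matrix (B × E) (B × E) ℂ where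
  toFun X := Matrix.of fun x y =>
    Ψ (Matrix.of fun a a' => X (a, x.2) (a', y.2)) x.1 y.1
  map_add' X Y := by
    ext x y
    exact congrFun (congrFun (Ψ.map_add (Matrix.of fun a a' => X (a, x.2) (a', y.2))
      (Matrix.of fun a a' => Y (a, x.2) (a', y.2))) x.1) y.1
  map_smul' c X := by
    ext x y
    exact congrFun (congrFun (Ψ.map_smul c (Matrix.of fun a a' => X (a, x.2) (a', y.2))) x.1) y.1

/-- A quantum channel: a completely positive trace preserving linear map. -/
structure IsChannel [Fintype A] [Fintype B] (Ψ : Matrix A A ℂ →ₗ[ℂ] Matrix B B ℂ) : Prop where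
  completelyPositive : ∀ (n : ℕ) (X : Matrix (A × Fin n) (A × Fin n) ℂ),
    X.PosSemidef → (tensorId Ψ (Fin n) X).PosSemidef
  tracePreserving : ∀ X : Matrix A A ℂ, (Ψ X).trace = X.trace

/-- A finite ensemble `{p_i, ρ_i}` of states. -/
structure IsEnsemble [Fintype A] [Fintype ι] (p : ι → ℝ) (ρ : ι → Matrix A A ℂ) : Prop where
  nonneg : ∀ i, 0 ≤ p i
  sum_eq_one : ∑ i, p i = 1
  isState : ∀ i, IsState (ρ i)

/-- The vector `ψ` on `A ⊗ E` is a purification of `ρ`. -/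
def IsPurification [Fintype E] (ψ : A × E → ℂ) (ρ : Matrix A A ℂ) : Prop :=
  partialTrace (ketBra ψ) = ρ

/-- The canonical purification `∑_a (√ρ ⊗ I) |a⟩|a⟩` of `ρ`, on two copies of `A`. -/
noncomputable def purification [Fintype A] [DecidableEq A] (ρ : Matrix A A ℂ) : A × A → ℂ :=
  fun x => (cfc Real.sqrt ρ) x.1 x.2

/-- The average input entropy `∑ p_i S(ρ_i)`, the entanglement consumed by an ensemble. -/
noncomputable def entanglementCost [Fintype A] [DecidableEq A] [Fintype ι]
    (p : ι → ℝ) (ρ : ι → Matrix A A ℂ) : ℝ :=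
  ∑ i, p i * entropy (ρ i)

/-- The information transmitted with entanglement assistance by an ensemble:
`∑ p_i S(ρ_i) + S(Ψ(∑ p_i ρ_i)) - ∑ p_i S((Ψ ⊗ I)(φ_i))`, with `φ_i` a purification of `ρ_i`. -/
noncomputable def chiAssist [Fintype A] [DecidableEq A] [Fintype B] [DecidableEq B] [Fintype ι]
    (Ψ : Matrix A A ℂ →ₗ[ℂ] Matrix B B ℂ) (p : ι → ℝ) (ρ : ι → Matrix A A ℂ) : ℝ :=
  ∑ i, p i * entropy (ρ i) + entropy (Ψ (∑ i, (p i : ℂ) • ρ i))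
    - ∑ i, p i * entropy (tensorId Ψ A (ketBra (purification (ρ i))))

/-- The values of `chiAssist` over all finite ensembles of average entropy at most `P`. -/
def achievable [Fintype A] [DecidableEq A] [Fintype B] [DecidableEq B]
    (Ψ : Matrix A A ℂ →ₗ[ℂ] Matrix B B ℂ) (P : ℝ) : Set ℝ :=
  {x | ∃ (n : ℕ) (p : Fin n → ℝ) (ρ : Fin n → Matrix A A ℂ),
    IsEnsemble p ρ ∧ entanglementCost p ρ ≤ P ∧ chiAssist Ψ p ρ = x}

/-- The one-shot classical capacity `C^{(1)}_P(Ψ)` with entanglement assistance `P`. -/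
noncomputable def capacity [Fintype A] [DecidableEq A] [Fintype B] [DecidableEq B]
    (Ψ : Matrix A A ℂ →ₗ[ℂ] Matrix B B ℂ) (P : ℝ) : ℝ :=
  sSup (achievable Ψ P)

end Basic

set_option linter.unusedSectionVars false

section WellDefined

/- `chiAssist` does not depend on the choice of the purifications. -/

variable {A B E : Type*} [Fintype A] [DecidableEq A] [Fintype B] [DecidableEq B]
  [Fintype E] [DecidableEq E]

theorem entropy_eq_roots {X : Matrix A A ℂ} (h : X.IsHermitian) :
    entropy X = (X.charpoly.roots.map fun z => Real.negMulLog z.re).sum / Real.log 2 := by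
  rw [entropy, dif_pos h, h.roots_charpoly_eq_eigenvalues]
  simp [Multiset.map_map]

theorem entropy_mul_comm {X : Matrix A A ℂ} {Y : Matrix B B ℂ} (hX : X.IsHermitian)
    (hY : Y.IsHermitian) (S : Matrix A B ℂ) (T : Matrix B A ℂ) (h1 : X = S * T)
    (h2 : Y = T * S) : entropy X = entropy Y := by
  rw [entropy_eq_roots hX, entropy_eq_roots hY]
  have h := Matrix.charpoly_mul_comm' S T
  rw [← h1, ← h2] at h
  have hr := congrArg Polynomial.roots h
  rw [Polynomial.roots_mul, Polynomial.roots_mul, Polynomial.roots_X_pow,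
    Polynomial.roots_X_pow] at hr
  · have hs := congrArg (fun m => (m.map fun z : ℂ => Real.negMulLog z.re).sum) hr
    simp [Multiset.map_nsmul, Multiset.sum_nsmul] at hs
    rw [hs]
  · exact mul_ne_zero (pow_ne_zero _ Polynomial.X_ne_zero) (Matrix.charpoly_monic _).ne_zero
  · exact mul_ne_zero (pow_ne_zero _ Polynomial.X_ne_zero) (Matrix.charpoly_monic _).ne_zero

theorem tensorId_conj {F : Type*} [Fintype F] [DecidableEq F]
    (Ψ : Matrix A A ℂ →ₗ[ℂ] Matrix B B ℂ)
    (U : Matrix F E ℂ) (V : Matrix E F ℂ) (X : Matrix (A × E) (A × E) ℂ) :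
    tensorId Ψ F (((1 : Matrix A A ℂ) ⊗ₖ U) * X * ((1 : Matrix A A ℂ) ⊗ₖ V)) =
      ((1 : Matrix B B ℂ) ⊗ₖ U) * tensorId Ψ E X * ((1 : Matrix B B ℂ) ⊗ₖ V) := by
  ext x y
  have h : (Matrix.of fun a a' => (((1 : Matrix A A ℂ) ⊗ₖ U) * X * ((1 : Matrix A A ℂ) ⊗ₖ V))
      (a, x.2) (a', y.2)) =
      ∑ e, ∑ f, (U x.2 e * V f y.2) • (Matrix.of fun a a' => X (a, e) (a', f)) := by
    ext a a'
    simp [Matrix.mul_apply, Matrix.sum_apply, Fintype.sum_prod_type, Matrix.kroneckerMap_apply,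
      Matrix.one_apply, Finset.sum_mul]
    rw [Finset.sum_comm]
    exact Finset.sum_congr rfl fun _ _ => Finset.sum_congr rfl fun _ _ => by ring
  have hL : tensorId Ψ F (((1 : Matrix A A ℂ) ⊗ₖ U) * X * ((1 : Matrix A A ℂ) ⊗ₖ V)) x y =
      ∑ e, ∑ f, (U x.2 e * V f y.2) * tensorId Ψ E X (x.1, e) (y.1, f) := by
    change Ψ _ _ _ = _
    rw [h]
    simp only [map_sum, map_smul, Matrix.sum_apply, Matrix.smul_apply, smul_eq_mul]
    rfl
  rw [hL]
  simp only [Matrix.mul_apply, Fintype.sum_prod_type, Matrix.kroneckerMap_apply,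
    Matrix.one_apply, Finset.sum_mul]
  simp
  rw [Finset.sum_comm]
  exact Finset.sum_congr rfl fun _ _ => Finset.sum_congr rfl fun _ _ => by ring

theorem IsChannel.posSemidef_tensorId {Ψ : Matrix A A ℂ →ₗ[ℂ] Matrix B B ℂ} (hΨ : IsChannel Ψ)
    {X : Matrix (A × E) (A × E) ℂ} (hX : X.PosSemidef) : (tensorId Ψ E X).PosSemidef := by
  let f := Fintype.equivFin E
  have h := hΨ.completelyPositive _ _
    (hX.submatrix (Prod.map (id : A → A) f.symm))
  have h2 := h.submatrix (Prod.map (id : B → B) f)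
  convert h2 using 1
  ext x y
  simp [tensorId, Matrix.submatrix]

theorem posSemidef_ketBra (ψ : A → ℂ) : (ketBra ψ).PosSemidef :=
  Matrix.posSemidef_vecMulVec_self_star ψ

theorem cfc_mul_matrix {ρ : Matrix A A ℂ} (f g : ℝ → ℝ) :
    cfc f ρ * cfc g ρ = cfc (fun x => f x * g x) ρ :=
  (cfc_mul f g ρ ((Set.toFinite _).continuousOn f) ((Set.toFinite _).continuousOn g)).symm

theorem cfc_congr_nonneg {ρ : Matrix A A ℂ} (hρ : ρ.PosSemidef) {f g : ℝ → ℝ}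
    (h : ∀ x, 0 ≤ x → f x = g x) : cfc f ρ = cfc g ρ := by
  refine cfc_congr fun x hx => h x ?_
  rw [hρ.isHermitian.spectrum_real_eq_range_eigenvalues] at hx
  obtain ⟨i, rfl⟩ := hx
  exact hρ.eigenvalues_nonneg i

theorem cfc_sqrt_mul_self {ρ : Matrix A A ℂ} (hρ : ρ.PosSemidef) :
    cfc Real.sqrt ρ * cfc Real.sqrt ρ = ρ := by
  rw [cfc_mul_matrix, cfc_congr_nonneg hρ (f := fun x => Real.sqrt x * Real.sqrt x) (g := id)
    fun x hx => Real.mul_self_sqrt hx]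
  exact cfc_id ℝ ρ hρ.isHermitian.isSelfAdjoint

theorem cfc_conjTranspose (ρ : Matrix A A ℂ) (f : ℝ → ℝ) : (cfc f ρ).conjTranspose = cfc f ρ :=
  (cfc_predicate f ρ : IsSelfAdjoint _)

theorem isPurification_purification {ρ : Matrix A A ℂ} (hρ : ρ.PosSemidef) :
    IsPurification (purification ρ) ρ := by
  have h : cfc Real.sqrt ρ * (cfc Real.sqrt ρ).conjTranspose = ρ := by
    rw [cfc_conjTranspose, cfc_sqrt_mul_self hρ]
  unfold IsPurification
  conv_rhs => rw [← h]
  ext a a'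
  simp [partialTrace, ketBra, purification, Matrix.vecMulVec_apply, Matrix.mul_apply]

theorem eq_mulVec_purification {F : Type*} [Fintype F] [DecidableEq F] {ρ : Matrix A A ℂ}
    (U : Matrix F A ℂ) (φ : A × F → ℂ)
    (h : ∀ x, φ x = ∑ a, cfc Real.sqrt ρ x.1 a * U x.2 a) :
    φ = ((1 : Matrix A A ℂ) ⊗ₖ U).mulVec (purification ρ) := by
  ext x
  simp [h, Matrix.mulVec, dotProduct, Fintype.sum_prod_type, Matrix.kroneckerMap_apply,
    Matrix.one_apply, purification, mul_comm]

/-- The entropy of `(Ψ ⊗ I)(φ)` is the same for every purification `φ` of `ρ`. -/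
theorem entropy_tensorId_purification {Ψ : Matrix A A ℂ →ₗ[ℂ] Matrix B B ℂ} (hΨ : IsChannel Ψ)
    {ρ : Matrix A A ℂ} (hρ : ρ.PosSemidef) {ψ : A × E → ℂ} (hψ : IsPurification ψ ρ) :
    entropy (tensorId Ψ E (ketBra ψ)) = entropy (tensorId Ψ A (ketBra (purification ρ))) := by
  let M : Matrix A E ℂ := Matrix.of fun a e => ψ (a, e)
  have hM : M * M.conjTranspose = ρ := by
    rw [← hψ]
    ext a a'
    simp [partialTrace, ketBra, Matrix.vecMulVec_apply, Matrix.mul_apply, M]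
  set s := cfc Real.sqrt ρ with hs
  set t := cfc (fun x => (Real.sqrt x)⁻¹) ρ with ht
  have hss : s * s = ρ := cfc_sqrt_mul_self hρ
  have hst : s * t = t * s := by
    rw [hs, ht, cfc_mul_matrix, cfc_mul_matrix]
    simp only [mul_comm]
  have hsts : s * t * s = s := by
    rw [hs, ht, cfc_mul_matrix, cfc_mul_matrix]
    exact cfc_congr_nonneg hρ fun x _ => mul_inv_mul_cancel _
  have hsH : s.conjTranspose = s := cfc_conjTranspose _ _
  have htH : t.conjTranspose = t := cfc_conjTranspose _ _
  have hPM : s * (t * M) = M := by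
    have h0 : (1 - s * t) * M = 0 := by
      rw [← Matrix.self_mul_conjTranspose_eq_zero, Matrix.conjTranspose_mul]
      have : (1 - s * t) * ρ = 0 := by
        rw [← hss, ← mul_assoc, sub_mul, hsts, one_mul, sub_self, zero_mul]
      rw [Matrix.mul_assoc, ← Matrix.mul_assoc M, hM, ← Matrix.mul_assoc, this, Matrix.zero_mul]
    rw [Matrix.sub_mul, Matrix.one_mul, sub_eq_zero] at h0
    rw [← Matrix.mul_assoc, ← h0]
  let W : Matrix A E ℂ := t * M
  have hsW : s * W = M := hPM
  have hWW : s * (W * W.conjTranspose) = s := by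
    rw [← Matrix.mul_assoc, hsW, Matrix.conjTranspose_mul, htH, ← Matrix.mul_assoc, hM, ← hss,
      mul_assoc, hst, ← mul_assoc, hsts]
  let V : Matrix E A ℂ := W.transpose
  have h1 : ketBra ψ = ((1 : Matrix A A ℂ) ⊗ₖ V) * ketBra (purification ρ) *
      ((1 : Matrix A A ℂ) ⊗ₖ V.conjTranspose) := by
    have h : ψ = ((1 : Matrix A A ℂ) ⊗ₖ V).mulVec (purification ρ) :=
      eq_mulVec_purification V ψ fun x => by
        simpa [Matrix.mul_apply, M, V] using (congrFun (congrFun hsW x.1) x.2).symm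
    conv_lhs => rw [h]
    rw [ketBra, ketBra, Matrix.mul_vecMulVec, Matrix.vecMulVec_mul, Matrix.star_mulVec,
      Matrix.conjTranspose_kronecker, Matrix.conjTranspose_one]
  have h2 : ketBra (purification ρ) = ((1 : Matrix A A ℂ) ⊗ₖ (1 : Matrix A A ℂ)) *
      ketBra (purification ρ) * ((1 : Matrix A A ℂ) ⊗ₖ (V.conjTranspose * V)) := by
    have hVH : (V.conjTranspose * V).conjTranspose = V.conjTranspose * V := by simp
    have hVV : V.conjTranspose * V = (W * W.conjTranspose).transpose := by
      rw [Matrix.transpose_mul]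
      rfl
    have h : purification ρ =
        ((1 : Matrix A A ℂ) ⊗ₖ (V.conjTranspose * V)).mulVec (purification ρ) :=
      eq_mulVec_purification _ _ fun x => by
        rw [hVV]
        simpa [Matrix.mul_apply, purification, ← hs] using
          (congrFun (congrFun hWW x.1) x.2).symm
    conv_lhs => rw [ketBra]; arg 2; rw [h]
    rw [Matrix.one_kronecker_one, Matrix.one_mul, Matrix.star_mulVec,
      Matrix.conjTranspose_kronecker, Matrix.conjTranspose_one, hVH, ketBra,
      Matrix.vecMulVec_mul]
  refine entropy_mul_comm (hΨ.posSemidef_tensorId (posSemidef_ketBra _)).isHermitian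
    (hΨ.posSemidef_tensorId (posSemidef_ketBra _)).isHermitian ((1 : Matrix B B ℂ) ⊗ₖ V)
    (tensorId Ψ A (ketBra (purification ρ)) * ((1 : Matrix B B ℂ) ⊗ₖ V.conjTranspose)) ?_ ?_
  · rw [h1, tensorId_conj, Matrix.mul_assoc]
  · conv_lhs => rw [h2]
    rw [tensorId_conj, Matrix.one_kronecker_one, Matrix.one_mul, Matrix.mul_assoc,
      ← Matrix.mul_kronecker_mul, Matrix.one_mul]

end WellDefined

section Dephasing

variable {R C J : Type*}

/-- The rank-one projection `|j⟩⟨j|` of an orthonormal basis. -/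
noncomputable def basisProj [Fintype R] [Fintype J]
    (b : OrthonormalBasis J ℂ (EuclideanSpace ℂ R)) (j : J) : Matrix R R ℂ :=
  ketBra fun r => b j r

/-- The noiseless classical channel `Π(ρ) = ∑_j |j⟩⟨j| ρ |j⟩⟨j|`. -/
noncomputable def dephasing [Fintype R] [Fintype J]
    (b : OrthonormalBasis J ℂ (EuclideanSpace ℂ R)) : Matrix R R ℂ →ₗ[ℂ] Matrix R R ℂ where
  toFun X := ∑ j, basisProj b j * X * basisProj b j
  map_add' X Y := by simp [Matrix.mul_add, Matrix.add_mul, Finset.sum_add_distrib]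
  map_smul' c X := by simp [Finset.smul_sum]

/-- The states `|j⟩⟨j| ⊗ ρ_ij` on `R ⊗ C`. -/
noncomputable def cqStates [Fintype R] [Fintype J] {ι : Type*}
    (b : OrthonormalBasis J ℂ (EuclideanSpace ℂ R)) (ρ : ι × J → Matrix C C ℂ) :
    ι × J → Matrix (R × C) (R × C) ℂ :=
  fun x => basisProj b x.2 ⊗ₖ ρ x

end Dephasing

end LimitedEA

namespace LimitedEA

set_option linter.unusedSectionVars false

/-! ### Entropy and the compact set of states -/

section StateSpace

variable {A B E : Type*} [Fintype A] [DecidableEq A] [Fintype B] [DecidableEq B]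
  [Fintype E] [DecidableEq E]

/-! Take a purification `ψ` of an input state `σ`, with reference `E`, and measure the register in
the basis `b`: `(⟨j| ⊗ I) ψ = √p_j φ_j`. Since `Ψ` ignores coherences between different `j`, the
joint output of `ψ` is the mixture with weights `p_j` of the joint outputs of `|j⟩ ⊗ φ_j`. These
vectors purify `|j⟩⟨j| ⊗ ρ_j`, so the mean channel output is unchanged. `Ψ` leaves the reference
alone, and the marginals of a pure state have equal entropy; hence the reference marginals have
entropies `S(|j⟩⟨j| ⊗ ρ_j)`, and their mixture has entropy `S(σ)`. Concavity of the entropy bounds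
the cost, and monotonicity of the Holevo quantity when the output `B` is discarded gives the
inequality for `chiAssist` (`exists_cqState_decomposition`).

That monotonicity reduces to monotonicity of relative entropy under a partial trace. The form `⟨X,
(L_Y + t R_X)⁻¹ X⟩` is the maximum of a quadratic functional of `Z`; the marginals only see
operators `1 ⊗ Z`, so their form is smaller. Integrating in `t` and renormalising as `t → ∞` yields
the relative entropy (`relEntropy_traceFst_le`). Concavity is the Holevo case of a trivial
reference.

For attainment, `chiAssist` and the cost depend only on the barycentre of the points `(ρ, S(ρ), S((Ψ
⊗ I)(φ)))`. These barycentres fill the convex hull of a compact set in finite dimension, so the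
achievable values form a compact set (`isCompact_achievable`). -/

theorem trace_cfc {X : Matrix A A ℂ} (h : X.IsHermitian) (f : ℝ → ℝ) :
    (cfc f X).trace = ∑ a, (f (h.eigenvalues a) : ℂ) := by
  rw [h.cfc_eq, Matrix.IsHermitian.cfc, Unitary.conjStarAlgAut_apply, Matrix.trace_mul_cycle,
    Unitary.coe_star_mul_self, Matrix.one_mul, Matrix.trace_diagonal]
  rfl

theorem entropy_eq_trace_cfc {X : Matrix A A ℂ} (h : X.IsHermitian) :
    entropy X = (cfc Real.negMulLog X).trace.re / Real.log 2 := by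
  rw [entropy, dif_pos h, trace_cfc h]
  simp

theorem IsState.isHermitian {ρ : Matrix A A ℂ} (h : IsState ρ) : ρ.IsHermitian := h.1.isHermitian

theorem IsState.sum_eigenvalues {ρ : Matrix A A ℂ} (h : IsState ρ) :
    ∑ i, h.isHermitian.eigenvalues i = 1 := by
  have ht := congrArg Complex.re h.2
  rw [h.isHermitian.trace_eq_sum_eigenvalues] at ht
  simpa using ht

theorem IsState.spectrum_subset {ρ : Matrix A A ℂ} (h : IsState ρ) :
    spectrum ℝ ρ ⊆ Set.Icc 0 1 := by
  rw [h.isHermitian.spectrum_real_eq_range_eigenvalues]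
  rintro _ ⟨i, rfl⟩
  refine ⟨h.1.eigenvalues_nonneg i, ?_⟩
  rw [← h.sum_eigenvalues]
  exact Finset.single_le_sum (f := h.isHermitian.eigenvalues)
    (fun i _ => h.1.eigenvalues_nonneg i) (Finset.mem_univ i)

-- The spectra of all states lie in the single compact set `[0, 1]`, so the functional calculus of a
-- fixed continuous function varies continuously.
open scoped Matrix.Norms.L2Operator in
theorem continuousOn_cfc_state {f : ℝ → ℝ} (hf : Continuous f) :
    ContinuousOn (fun ρ : Matrix A A ℂ => cfc f ρ) {ρ | IsState ρ} :=
  (continuousOn_cfc (Matrix A A ℂ) (isCompact_Icc (a := (0 : ℝ)) (b := 1)) f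
    hf.continuousOn).mono fun _ h => ⟨h.isHermitian, h.spectrum_subset⟩

theorem continuousOn_entropy : ContinuousOn (entropy (A := A)) {ρ | IsState ρ} := by
  have h : ContinuousOn (fun ρ : Matrix A A ℂ => (cfc Real.negMulLog ρ).trace.re / Real.log 2)
      {ρ | IsState ρ} := by
    have h1 := continuousOn_cfc_state (A := A) Real.continuous_negMulLog
    have h2 : Continuous fun X : Matrix A A ℂ => X.trace.re / Real.log 2 :=
      (Complex.continuous_re.comp continuous_id.matrix_trace).div_const _
    exact h2.comp_continuousOn h1
  exact h.congr fun ρ hρ => entropy_eq_trace_cfc hρ.isHermitian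

/-- States are exactly the matrices `M* M` with `M` of Hilbert–Schmidt norm one, a continuous image
of a sphere. -/
theorem isCompact_setOf_isState : IsCompact {ρ : Matrix A A ℂ | IsState ρ} := by
  let f : EuclideanSpace ℂ (A × A) → Matrix A A ℂ := fun v =>
    (Matrix.of fun a a' => v (a, a')).conjTranspose * Matrix.of fun a a' => v (a, a')
  have hf : Continuous f := by
    refine continuous_matrix fun i j => ?_
    simp only [f, Matrix.mul_apply, Matrix.conjTranspose_apply, Matrix.of_apply]
    fun_prop
  have htr : ∀ v, (f v).trace = ((‖v‖ ^ 2 : ℝ) : ℂ) := by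
    intro v
    rw [EuclideanSpace.norm_sq_eq, Fintype.sum_prod_type, Finset.sum_comm]
    simp [f, Matrix.trace, Matrix.mul_apply, ← Complex.conj_mul']
  convert (isCompact_sphere (0 : EuclideanSpace ℂ (A × A)) 1).image hf using 1
  ext ρ
  constructor
  · rintro ⟨h1, h2⟩
    obtain ⟨M, hM⟩ : ∃ M : Matrix A A ℂ, ρ = M.conjTranspose * M :=
      ⟨cfc Real.sqrt ρ, by rw [cfc_conjTranspose, cfc_sqrt_mul_self h1]⟩
    have hfM : f (WithLp.toLp 2 fun x => M x.1 x.2) = ρ := by rw [hM]; rfl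
    refine ⟨_, ?_, hfM⟩
    have h3 := htr (WithLp.toLp 2 fun x => M x.1 x.2)
    rw [hfM, h2] at h3
    rw [mem_sphere_zero_iff_norm]
    have h4 : ‖(WithLp.toLp 2 fun x => M x.1 x.2 : EuclideanSpace ℂ (A × A))‖ ^ 2 = 1 := by
      exact_mod_cast h3.symm
    exact (pow_eq_one_iff_of_nonneg (norm_nonneg _) two_ne_zero).1 h4
  · rintro ⟨v, hv, rfl⟩
    refine ⟨Matrix.posSemidef_conjTranspose_mul_self _, ?_⟩
    rw [htr, mem_sphere_zero_iff_norm.1 hv]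
    simp

theorem trace_ketBra (ψ : A → ℂ) : (ketBra ψ).trace = ((∑ a, ‖ψ a‖ ^ 2 : ℝ) : ℂ) := by
  simp [ketBra, Matrix.trace, Matrix.vecMulVec_apply, Complex.mul_conj']

theorem trace_partialTrace (X : Matrix (A × E) (A × E) ℂ) :
    (partialTrace X).trace = X.trace := by
  simp [partialTrace, Matrix.trace, Fintype.sum_prod_type]

theorem partialTrace_eq_sum (X : Matrix (A × E) (A × E) ℂ) :
    partialTrace X = ∑ e, X.submatrix (fun a => (a, e)) (fun a => (a, e)) := by
  ext a a'
  simp [partialTrace, Matrix.sum_apply]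

theorem posSemidef_partialTrace {X : Matrix (A × E) (A × E) ℂ} (hX : X.PosSemidef) :
    (partialTrace X).PosSemidef := by
  rw [partialTrace_eq_sum]
  exact Matrix.posSemidef_sum _ fun e _ => hX.submatrix _

theorem IsState.partialTrace {X : Matrix (A × E) (A × E) ℂ} (hX : IsState X) :
    IsState (partialTrace X) :=
  ⟨posSemidef_partialTrace hX.1, by rw [trace_partialTrace, hX.2]⟩

/-- The operator on `E ⊗ A` obtained from one on `A ⊗ E` by exchanging the factors. -/
def swapFactors (X : Matrix (A × E) (A × E) ℂ) : Matrix (E × A) (E × A) ℂ :=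
  X.submatrix Prod.swap Prod.swap

theorem trace_swapFactors (X : Matrix (A × E) (A × E) ℂ) : (swapFactors X).trace = X.trace := by
  simp only [swapFactors, Matrix.trace, Fintype.sum_prod_type, Matrix.diag_apply,
    Matrix.submatrix_apply, Prod.swap_prod_mk]
  exact Finset.sum_comm

theorem IsState.swapFactors {X : Matrix (A × E) (A × E) ℂ} (hX : IsState X) :
    IsState (swapFactors X) :=
  ⟨hX.1.submatrix _, by rw [trace_swapFactors, hX.2]⟩

theorem entropy_transpose {X : Matrix A A ℂ} (h : X.IsHermitian) :
    entropy X.transpose = entropy X := by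
  rw [entropy_eq_roots h, entropy_eq_roots h.transpose, Matrix.charpoly_transpose]

/-- The two marginals of a pure state have the same entropy. -/
theorem entropy_partialTrace_swapFactors_ketBra (ψ : A × E → ℂ) :
    entropy (partialTrace (swapFactors (ketBra ψ))) = entropy (partialTrace (ketBra ψ)) := by
  -- Reshaped as a matrix `M`, the vector has marginals `M M*` and `(M* M)ᵀ`, which share their
  -- nonzero spectrum.
  let M : Matrix A E ℂ := Matrix.of fun a e => ψ (a, e)
  have h1 : partialTrace (ketBra ψ) = M * M.conjTranspose := by
    ext a a'
    simp [partialTrace, ketBra, Matrix.vecMulVec_apply, Matrix.mul_apply, M]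
  have h2 : partialTrace (swapFactors (ketBra ψ)) = (M.conjTranspose * M).transpose := by
    ext e e'
    simp [partialTrace, swapFactors, ketBra, Matrix.vecMulVec_apply, Matrix.mul_apply, M, mul_comm]
  have h3 := (Matrix.posSemidef_conjTranspose_mul_self M).isHermitian
  rw [h1, h2, entropy_transpose h3]
  exact entropy_mul_comm h3 (Matrix.posSemidef_self_mul_conjTranspose M).isHermitian _ _ rfl rfl

theorem IsState.ketBra {ψ : A → ℂ} (h : ∑ a, ‖ψ a‖ ^ 2 = 1) : IsState (ketBra ψ) :=
  ⟨posSemidef_ketBra ψ, by rw [trace_ketBra, h, Complex.ofReal_one]⟩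

theorem IsState.sum {ι : Type*} [Fintype ι] {p : ι → ℝ} {ρ : ι → Matrix A A ℂ}
    (h : IsEnsemble p ρ) : IsState (∑ i, (p i : ℂ) • ρ i) := by
  refine ⟨Matrix.posSemidef_sum _ fun i _ => (h.isState i).1.smul ?_, ?_⟩
  · exact_mod_cast h.nonneg i
  · simp only [Matrix.trace_sum, Matrix.trace_smul, (h.isState _).2, smul_eq_mul, mul_one]
    exact_mod_cast h.sum_eq_one

theorem entropy_of_unique [Unique A] {ρ : Matrix A A ℂ} (h : IsState ρ) : entropy ρ = 0 := by
  have hs := h.sum_eigenvalues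
  rw [Fintype.sum_unique] at hs
  rw [entropy, dif_pos h.isHermitian, Fintype.sum_unique, hs]
  simp

end StateSpace

/-! ### Relative entropy and its monotonicity under partial traces -/

section RelativeEntropy

open Filter Topology

variable {A B E : Type*} [Fintype A] [DecidableEq A] [Fintype B] [DecidableEq B]
  [Fintype E] [DecidableEq E]

/-- The unitary matrix whose columns are the eigenvectors of `X`. -/
noncomputable def eigenMatrix {X : Matrix A A ℂ} (h : X.IsHermitian) : Matrix A A ℂ :=
  h.eigenvectorUnitary

theorem eigenMatrix_mul_conjTranspose {X : Matrix A A ℂ} (h : X.IsHermitian) :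
    eigenMatrix h * (eigenMatrix h).conjTranspose = 1 :=
  Unitary.coe_mul_star_self h.eigenvectorUnitary

theorem conjTranspose_mul_eigenMatrix {X : Matrix A A ℂ} (h : X.IsHermitian) :
    (eigenMatrix h).conjTranspose * eigenMatrix h = 1 :=
  Unitary.coe_star_mul_self h.eigenvectorUnitary

theorem cfc_eq_eigenMatrix {X : Matrix A A ℂ} (h : X.IsHermitian) (f : ℝ → ℝ) :
    cfc f X = eigenMatrix h * Matrix.diagonal (fun i => (f (h.eigenvalues i) : ℂ)) *
      (eigenMatrix h).conjTranspose := by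
  rw [h.cfc_eq, Matrix.IsHermitian.cfc, Unitary.conjStarAlgAut_apply]
  rfl

theorem eq_eigenMatrix {X : Matrix A A ℂ} (h : X.IsHermitian) :
    X = eigenMatrix h * Matrix.diagonal (fun i => (h.eigenvalues i : ℂ)) *
      (eigenMatrix h).conjTranspose := by
  have := cfc_eq_eigenMatrix h id
  rwa [cfc_id ℝ X h.isSelfAdjoint] at this

/-- The inner products of the eigenvectors of `Y` with those of `X`. -/
noncomputable def eigenInner {X Y : Matrix A A ℂ} (hX : X.IsHermitian) (hY : Y.IsHermitian) :
    Matrix A A ℂ :=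
  (eigenMatrix hY).conjTranspose * eigenMatrix hX

/-- The transition probabilities between the eigenvectors of `Y` and those of `X`. -/
noncomputable def overlap {X Y : Matrix A A ℂ} (hX : X.IsHermitian) (hY : Y.IsHermitian)
    (i j : A) : ℝ :=
  ‖eigenInner hX hY i j‖ ^ 2

theorem sum_overlap {X Y : Matrix A A ℂ} (hX : X.IsHermitian) (hY : Y.IsHermitian) (j : A) :
    ∑ i, overlap hX hY i j = 1 := by
  have h : (eigenInner hX hY).conjTranspose * eigenInner hX hY = 1 := by
    rw [eigenInner, Matrix.conjTranspose_mul, Matrix.conjTranspose_conjTranspose,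
      Matrix.mul_assoc, ← Matrix.mul_assoc (eigenMatrix hY), eigenMatrix_mul_conjTranspose,
      Matrix.one_mul, conjTranspose_mul_eigenMatrix]
  have h2 := congrFun (congrFun h j) j
  simp only [Matrix.mul_apply, Matrix.conjTranspose_apply, Matrix.one_apply_eq,
    RCLike.star_def, Complex.conj_mul'] at h2
  unfold overlap
  exact_mod_cast h2

theorem trace_mul_diagonal_eq_sum (M : Matrix A A ℂ) (d : A → ℂ) :
    (M * Matrix.diagonal d).trace = ∑ i, M i i * d i := by
  simp [Matrix.trace]

theorem trace_mul_cfc {X Y : Matrix A A ℂ} (hX : X.IsHermitian) (hY : Y.IsHermitian)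
    (f : ℝ → ℝ) : (X * cfc f Y).trace =
      ((∑ i, ∑ j, overlap hX hY i j * (hX.eigenvalues j * f (hY.eigenvalues i)) : ℝ) : ℂ) := by
  have h1 : (X * cfc f Y).trace = (eigenInner hX hY *
      Matrix.diagonal (fun i => (hX.eigenvalues i : ℂ)) * (eigenInner hX hY).conjTranspose *
      Matrix.diagonal (fun i => (f (hY.eigenvalues i) : ℂ))).trace := by
    conv_lhs => rw [cfc_eq_eigenMatrix hY, eq_eigenMatrix hX]
    simp only [eigenInner, Matrix.conjTranspose_mul, Matrix.conjTranspose_conjTranspose,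
      ← Matrix.mul_assoc]
    rw [Matrix.trace_mul_comm]
    simp only [← Matrix.mul_assoc]
  rw [h1, trace_mul_diagonal_eq_sum]
  simp only [overlap]
  push_cast
  refine Finset.sum_congr rfl fun i _ => ?_
  rw [Matrix.mul_apply, Finset.sum_mul]
  refine Finset.sum_congr rfl fun j _ => ?_
  rw [Matrix.mul_diagonal, Matrix.conjTranspose_apply, RCLike.star_def]
  rw [← Complex.mul_conj']
  ring

/-- The quadratic functional whose maximum over `Z` is the resolvent form
`⟨X, (L_Y + t R_X)⁻¹ X⟩` of the pair of left and right multiplications. -/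
noncomputable def resolventFunctional (t : ℝ) (X Y Z : Matrix A A ℂ) : ℝ :=
  (2 * (Z.conjTranspose * X).trace - (Z * Z.conjTranspose * Y).trace
    - t * (Z.conjTranspose * Z * X).trace).re

/-- The resolvent form `⟨X, (L_Y + t R_X)⁻¹ X⟩` in the eigenbases of `X` and `Y`. -/
noncomputable def resolventForm (t : ℝ) {X Y : Matrix A A ℂ} (hX : X.IsHermitian)
    (hY : Y.IsHermitian) : ℝ :=
  ∑ i, ∑ j, overlap hX hY i j * hX.eigenvalues j ^ 2 /
    (hY.eigenvalues i + t * hX.eigenvalues j)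

/-- In coordinates `z` between the two eigenbases the functional decouples into one scalar quadratic
per entry, so it can be maximised entry by entry. -/
theorem resolventFunctional_eq (t : ℝ) {X Y : Matrix A A ℂ} (hX : X.IsHermitian)
    (hY : Y.IsHermitian) (z : Matrix A A ℂ) :
    resolventFunctional t X Y (eigenMatrix hY * z * (eigenMatrix hX).conjTranspose) =
      ∑ i, ∑ j, (2 * (star (z i j) * eigenInner hX hY i j).re * hX.eigenvalues j -
        (hY.eigenvalues i + t * hX.eigenvalues j) * ‖z i j‖ ^ 2) := by
  set U := eigenMatrix hX with hU
  set V := eigenMatrix hY with hV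
  set a : Matrix A A ℂ := Matrix.diagonal fun i => (hX.eigenvalues i : ℂ) with ha
  set b : Matrix A A ℂ := Matrix.diagonal fun i => (hY.eigenvalues i : ℂ) with hb
  have hUU : U.conjTranspose * U = 1 := conjTranspose_mul_eigenMatrix hX
  have hVV : V.conjTranspose * V = 1 := conjTranspose_mul_eigenMatrix hY
  have hXe : X = U * a * U.conjTranspose := eq_eigenMatrix hX
  have hYe : Y = V * b * V.conjTranspose := eq_eigenMatrix hY
  have cU : ∀ M : Matrix A A ℂ, U.conjTranspose * (U * M) = M := fun M => by
    rw [← Matrix.mul_assoc, hUU, Matrix.one_mul]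
  have cV : ∀ M : Matrix A A ℂ, V.conjTranspose * (V * M) = M := fun M => by
    rw [← Matrix.mul_assoc, hVV, Matrix.one_mul]
  have h1 : ((V * z * U.conjTranspose).conjTranspose * X).trace =
      (z.conjTranspose * eigenInner hX hY * a).trace := by
    conv_lhs => rw [hXe]
    simp only [Matrix.conjTranspose_mul, Matrix.conjTranspose_conjTranspose, Matrix.mul_assoc]
    rw [Matrix.trace_mul_comm]
    simp only [Matrix.mul_assoc, hUU, Matrix.mul_one, eigenInner, ← hU, ← hV]
  have h2 : ((V * z * U.conjTranspose) * (V * z * U.conjTranspose).conjTranspose * Y).trace =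
      (z * z.conjTranspose * b).trace := by
    conv_lhs => rw [hYe]
    simp only [Matrix.conjTranspose_mul, Matrix.conjTranspose_conjTranspose, Matrix.mul_assoc,
      cU, cV]
    rw [Matrix.trace_mul_comm]
    simp only [Matrix.mul_assoc, hVV, Matrix.mul_one]
  have h3 : ((V * z * U.conjTranspose).conjTranspose * (V * z * U.conjTranspose) * X).trace =
      (z.conjTranspose * z * a).trace := by
    conv_lhs => rw [hXe]
    simp only [Matrix.conjTranspose_mul, Matrix.conjTranspose_conjTranspose, Matrix.mul_assoc,
      cU, cV]
    rw [Matrix.trace_mul_comm]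
    simp only [Matrix.mul_assoc, hUU, Matrix.mul_one]
  have e1 : (z.conjTranspose * eigenInner hX hY * a).trace.re =
      ∑ i, ∑ j, (star (z i j) * eigenInner hX hY i j).re * hX.eigenvalues j := by
    rw [Finset.sum_comm, ha, trace_mul_diagonal_eq_sum]
    simp only [Complex.re_sum, Complex.re_mul_ofReal, Matrix.mul_apply,
      Matrix.conjTranspose_apply, Finset.sum_mul]
  have e2 : (z * z.conjTranspose * b).trace.re =
      ∑ i, ∑ j, hY.eigenvalues i * ‖z i j‖ ^ 2 := by
    rw [hb, trace_mul_diagonal_eq_sum]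
    simp only [Complex.re_sum, Complex.re_mul_ofReal, Matrix.mul_apply,
      Matrix.conjTranspose_apply, RCLike.star_def, Complex.mul_conj', Finset.sum_mul]
    refine Finset.sum_congr rfl fun i _ => Finset.sum_congr rfl fun j _ => ?_
    rw [← Complex.ofReal_pow, Complex.ofReal_re, mul_comm]
  have e3 : (z.conjTranspose * z * a).trace.re =
      ∑ i, ∑ j, hX.eigenvalues j * ‖z i j‖ ^ 2 := by
    rw [Finset.sum_comm, ha, trace_mul_diagonal_eq_sum]
    simp only [Complex.re_sum, Complex.re_mul_ofReal, Matrix.mul_apply,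
      Matrix.conjTranspose_apply, RCLike.star_def, Complex.conj_mul', Finset.sum_mul]
    refine Finset.sum_congr rfl fun i _ => Finset.sum_congr rfl fun j _ => ?_
    rw [← Complex.ofReal_pow, Complex.ofReal_re, mul_comm]
  rw [resolventFunctional, h1, h2, h3, Complex.sub_re, Complex.sub_re, Complex.re_ofReal_mul,
    e2, e3, ← Complex.ofReal_ofNat, Complex.re_ofReal_mul, e1]
  simp only [Finset.mul_sum, ← Finset.sum_sub_distrib]
  refine Finset.sum_congr rfl fun i _ => Finset.sum_congr rfl fun j _ => ?_
  ring

theorem resolventFunctional_le {t : ℝ} (ht : 0 ≤ t) {X Y : Matrix A A ℂ} (hX : X.PosDef)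
    (hY : Y.PosDef) (Z : Matrix A A ℂ) :
    resolventFunctional t X Y Z ≤ resolventForm t hX.isHermitian hY.isHermitian := by
  obtain ⟨z, rfl⟩ : ∃ z, Z = eigenMatrix hY.isHermitian * z *
      (eigenMatrix hX.isHermitian).conjTranspose :=
    ⟨(eigenMatrix hY.isHermitian).conjTranspose * Z * eigenMatrix hX.isHermitian, by
      simp only [Matrix.mul_assoc, eigenMatrix_mul_conjTranspose, Matrix.mul_one]
      rw [← Matrix.mul_assoc, eigenMatrix_mul_conjTranspose, Matrix.one_mul]⟩
  rw [resolventFunctional_eq, resolventForm]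
  refine Finset.sum_le_sum fun i _ => Finset.sum_le_sum fun j _ => ?_
  have ha := hX.eigenvalues_pos j
  have hb := hY.eigenvalues_pos i
  generalize hX.isHermitian.eigenvalues j = a at *
  generalize hY.isHermitian.eigenvalues i = b at *
  have hc : 0 < b + t * a := by positivity
  rw [overlap, le_div_iff₀ hc]
  set w := eigenInner hX.isHermitian hY.isHermitian i j
  have hre : (star (z i j) * w).re ≤ ‖z i j‖ * ‖w‖ := by
    refine (Complex.re_le_norm _).trans ?_
    rw [norm_mul, norm_star]
  have h1 : 2 * (star (z i j) * w).re * a ≤ 2 * (‖z i j‖ * ‖w‖) * a := by gcongr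
  have h2 := mul_le_mul_of_nonneg_right h1 hc.le
  -- Completing the square, after clearing the denominator `b + t * a`.
  nlinarith [sq_nonneg ((b + t * a) * ‖z i j‖ - ‖w‖ * a)]

theorem exists_resolventFunctional_eq {t : ℝ} (ht : 0 ≤ t) {X Y : Matrix A A ℂ} (hX : X.PosDef)
    (hY : Y.PosDef) : ∃ Z,
    resolventFunctional t X Y Z = resolventForm t hX.isHermitian hY.isHermitian := by
  -- Each entry `a w / (b + t a)` is the maximiser of its scalar quadratic.
  refine ⟨eigenMatrix hY.isHermitian * (Matrix.of fun i j =>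
    ((hX.isHermitian.eigenvalues j / (hY.isHermitian.eigenvalues i +
      t * hX.isHermitian.eigenvalues j) : ℝ) : ℂ) *
      eigenInner hX.isHermitian hY.isHermitian i j) *
      (eigenMatrix hX.isHermitian).conjTranspose, ?_⟩
  rw [resolventFunctional_eq, resolventForm]
  refine Finset.sum_congr rfl fun i _ => Finset.sum_congr rfl fun j _ => ?_
  rw [overlap, Matrix.of_apply]
  have ha := hX.eigenvalues_pos j
  have hb := hY.eigenvalues_pos i
  generalize hX.isHermitian.eigenvalues j = a at *
  generalize hY.isHermitian.eigenvalues i = b at *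
  have hc : 0 < b + t * a := by positivity
  set w := eigenInner hX.isHermitian hY.isHermitian i j
  have h1 : (star (((a / (b + t * a) : ℝ) : ℂ) * w) * w).re = a / (b + t * a) * ‖w‖ ^ 2 := by
    rw [star_mul', RCLike.star_def, Complex.conj_ofReal, mul_assoc,
      Complex.conj_mul', ← Complex.ofReal_pow, Complex.re_ofReal_mul, Complex.ofReal_re]
  rw [h1, norm_mul, Complex.norm_real, Real.norm_of_nonneg (by positivity)]
  field_simp
  ring

/-- The marginal `tr_B X` on the second factor. -/
def traceFst (X : Matrix (B × E) (B × E) ℂ) : Matrix E E ℂ :=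
  partialTrace (swapFactors X)

theorem trace_one_kronecker_mul (Z : Matrix E E ℂ) (X : Matrix (B × E) (B × E) ℂ) :
    (((1 : Matrix B B ℂ) ⊗ₖ Z) * X).trace = (Z * traceFst X).trace := by
  simp only [Matrix.trace, Matrix.diag_apply, Matrix.mul_apply, Fintype.sum_prod_type,
    Matrix.kroneckerMap_apply, Matrix.one_apply, traceFst, partialTrace, swapFactors,
    Matrix.of_apply, Matrix.submatrix_apply, Prod.swap_prod_mk, Finset.mul_sum]
  simp only [ite_mul, one_mul, zero_mul, Finset.sum_ite_irrel, Finset.sum_const_zero,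
    Finset.sum_ite_eq, Finset.mem_univ, if_true]
  rw [Finset.sum_comm]
  exact Finset.sum_congr rfl fun _ _ => Finset.sum_comm

/-- `Z ↦ 1 ⊗ Z` respects products and adjoints, and it is dual to the partial trace. -/
theorem resolventFunctional_traceFst (t : ℝ) (X Y : Matrix (B × E) (B × E) ℂ)
    (Z : Matrix E E ℂ) : resolventFunctional t (traceFst X) (traceFst Y) Z =
      resolventFunctional t X Y ((1 : Matrix B B ℂ) ⊗ₖ Z) := by
  simp only [resolventFunctional, Matrix.conjTranspose_kronecker, Matrix.conjTranspose_one,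
    ← Matrix.mul_kronecker_mul, Matrix.one_mul, trace_one_kronecker_mul]

/-- The form of the marginals is attained at some `Z`; evaluating the full functional at `1 ⊗ Z`
gives the same value, which is at most its maximum. -/
theorem resolventForm_traceFst_le {t : ℝ} (ht : 0 ≤ t) {X Y : Matrix (B × E) (B × E) ℂ}
    (hX : X.PosDef) (hY : Y.PosDef) (hX' : (traceFst X).PosDef) (hY' : (traceFst Y).PosDef) :
    resolventForm t hX'.isHermitian hY'.isHermitian ≤
      resolventForm t hX.isHermitian hY.isHermitian := by
  obtain ⟨Z, hZ⟩ := exists_resolventFunctional_eq ht hX' hY'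
  rw [← hZ, resolventFunctional_traceFst]
  exact resolventFunctional_le ht hX hY _

/-- The integral of the resolvent form over `[0, t]`. -/
noncomputable def resolventIntegral (t : ℝ) {X Y : Matrix A A ℂ} (hX : X.IsHermitian)
    (hY : Y.IsHermitian) : ℝ :=
  ∑ i, ∑ j, overlap hX hY i j * (hX.eigenvalues j *
    (Real.log (hY.eigenvalues i + t * hX.eigenvalues j) - Real.log (hY.eigenvalues i)))

theorem hasDerivAt_resolventIntegral {t : ℝ} (ht : 0 ≤ t) {X Y : Matrix A A ℂ} (hX : X.PosDef)
    (hY : Y.PosDef) :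
    HasDerivAt (fun t => resolventIntegral t hX.isHermitian hY.isHermitian)
      (resolventForm t hX.isHermitian hY.isHermitian) t := by
  unfold resolventIntegral resolventForm
  refine HasDerivAt.fun_sum fun i _ => HasDerivAt.fun_sum fun j _ => ?_
  have ha := hX.eigenvalues_pos j
  have hb := hY.eigenvalues_pos i
  generalize hX.isHermitian.eigenvalues j = a at *
  generalize hY.isHermitian.eigenvalues i = b at *
  have hc : b + t * a ≠ 0 := by positivity
  have h1 : HasDerivAt (fun t => b + t * a) a t := by
    simpa using ((hasDerivAt_id t).mul_const a).const_add b
  have h2 := (((h1.log hc).sub_const (Real.log b)).const_mul a).const_mul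
    (overlap hX.isHermitian hY.isHermitian i j)
  convert! h2 using 1
  ring

/-- Both integrals vanish at `t = 0`, and the derivative of their difference is nonnegative. -/
theorem resolventIntegral_traceFst_le {t : ℝ} (ht : 0 ≤ t) {X Y : Matrix (B × E) (B × E) ℂ}
    (hX : X.PosDef) (hY : Y.PosDef) (hX' : (traceFst X).PosDef) (hY' : (traceFst Y).PosDef) :
    resolventIntegral t hX'.isHermitian hY'.isHermitian ≤
      resolventIntegral t hX.isHermitian hY.isHermitian := by
  have hd : ∀ s : ℝ, 0 ≤ s → HasDerivAt (fun s => resolventIntegral s hX.isHermitian hY.isHermitian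
      - resolventIntegral s hX'.isHermitian hY'.isHermitian)
      (resolventForm s hX.isHermitian hY.isHermitian -
        resolventForm s hX'.isHermitian hY'.isHermitian) s := fun s hs =>
    (hasDerivAt_resolventIntegral hs hX hY).sub (hasDerivAt_resolventIntegral hs hX' hY')
  have hm : MonotoneOn (fun s => resolventIntegral s hX.isHermitian hY.isHermitian
      - resolventIntegral s hX'.isHermitian hY'.isHermitian) (Set.Ici 0) := by
    refine monotoneOn_of_deriv_nonneg (convex_Ici 0)
      (fun s hs => (hd s hs).continuousAt.continuousWithinAt)
      (fun s hs => ?_) fun s hs => ?_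
    all_goals rw [interior_Ici] at hs
    · exact (hd s (le_of_lt hs)).differentiableAt.differentiableWithinAt
    · rw [(hd s (le_of_lt hs)).deriv]
      exact sub_nonneg.2 (resolventForm_traceFst_le (le_of_lt hs) hX hY hX' hY')
  have h := hm (Set.mem_Ici.2 le_rfl) (Set.mem_Ici.2 ht) ht
  simpa [resolventIntegral] using h

/-- The relative entropy `tr X (log X - log Y)`, in nats. -/
noncomputable def relEntropy {X Y : Matrix A A ℂ} (hX : X.IsHermitian) (hY : Y.IsHermitian) : ℝ :=
  ∑ i, ∑ j, overlap hX hY i j * (hX.eigenvalues j *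
    (Real.log (hX.eigenvalues j) - Real.log (hY.eigenvalues i)))

theorem sum_overlap_mul {X Y : Matrix A A ℂ} (hX : X.IsHermitian) (hY : Y.IsHermitian)
    (f : A → ℝ) : ∑ i, ∑ j, overlap hX hY i j * f j = ∑ j, f j := by
  rw [Finset.sum_comm]
  simp only [← Finset.sum_mul, sum_overlap, one_mul]

/-- The overlaps sum to one over `i`, so subtracting `tr X log t` turns each `log (b + t a)` into
`log (b / t + a)`, which tends to `log a`. -/
theorem tendsto_resolventIntegral {X Y : Matrix A A ℂ} (hX : X.PosDef) (hY : Y.PosDef) :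
    Tendsto (fun t => resolventIntegral t hX.isHermitian hY.isHermitian -
      X.trace.re * Real.log t) atTop (𝓝 (relEntropy hX.isHermitian hY.isHermitian)) := by
  have h : ∀ t : ℝ, 0 < t → ∑ i, ∑ j, overlap hX.isHermitian hY.isHermitian i j *
      (hX.isHermitian.eigenvalues j *
      (Real.log (hY.isHermitian.eigenvalues i * t⁻¹ + hX.isHermitian.eigenvalues j) -
        Real.log (hY.isHermitian.eigenvalues i))) =
      resolventIntegral t hX.isHermitian hY.isHermitian - X.trace.re * Real.log t := by
    intro t ht
    have htr : X.trace.re = ∑ j, hX.isHermitian.eigenvalues j := by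
      rw [hX.isHermitian.trace_eq_sum_eigenvalues]
      simp
    rw [htr, ← sum_overlap_mul hX.isHermitian hY.isHermitian hX.isHermitian.eigenvalues,
      resolventIntegral, Finset.sum_mul,
      ← Finset.sum_sub_distrib]
    refine Finset.sum_congr rfl fun i _ => ?_
    rw [Finset.sum_mul, ← Finset.sum_sub_distrib]
    refine Finset.sum_congr rfl fun j _ => ?_
    have ha := hX.eigenvalues_pos j
    have hb := hY.eigenvalues_pos i
    generalize hX.isHermitian.eigenvalues j = a at *
    generalize hY.isHermitian.eigenvalues i = b at *
    have e : b * t⁻¹ + a = (b + t * a) / t := by field_simp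
    rw [e, Real.log_div (by positivity) ht.ne']
    ring
  refine Tendsto.congr' (f₁ := _) ((eventually_gt_atTop 0).mono h) ?_
  refine tendsto_finsetSum _ fun i _ => tendsto_finsetSum _ fun j _ => ?_
  have ha := hX.eigenvalues_pos j
  refine Tendsto.const_mul _ (Tendsto.const_mul _ (Tendsto.sub_const (Tendsto.log ?_ ha.ne') _))
  simpa using (tendsto_inv_atTop_zero.const_mul (hY.isHermitian.eigenvalues i)).add_const
    (hX.isHermitian.eigenvalues j)

/-- Monotonicity of the relative entropy under partial traces. -/
theorem relEntropy_traceFst_le {X Y : Matrix (B × E) (B × E) ℂ}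
    (hX : X.PosDef) (hY : Y.PosDef) (hX' : (traceFst X).PosDef) (hY' : (traceFst Y).PosDef) :
    relEntropy hX'.isHermitian hY'.isHermitian ≤ relEntropy hX.isHermitian hY.isHermitian := by
  refine le_of_tendsto_of_tendsto (tendsto_resolventIntegral hX' hY')
    (tendsto_resolventIntegral hX hY) ((eventually_ge_atTop 0).mono fun t ht => ?_)
  -- The divergent terms subtracted on the two sides coincide.
  have htr : (traceFst X).trace = X.trace := by
    rw [traceFst, trace_partialTrace, trace_swapFactors]
  simp only [htr]
  exact sub_le_sub_right (resolventIntegral_traceFst_le ht hX hY hX' hY') _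

/-- The cross term is linear in `X`, hence can be averaged over an ensemble. -/
theorem relEntropy_eq {X Y : Matrix A A ℂ} (hX : X.IsHermitian) (hY : Y.IsHermitian) :
    relEntropy hX hY = -(entropy X * Real.log 2) - (X * cfc Real.log Y).trace.re := by
  have hlog : Real.log 2 ≠ 0 := (Real.log_pos one_lt_two).ne'
  rw [trace_mul_cfc hX hY, Complex.ofReal_re, entropy, dif_pos hX, div_mul_cancel₀ _ hlog,
    ← sum_overlap_mul hX hY, relEntropy]
  simp only [← Finset.sum_neg_distrib, ← Finset.sum_sub_distrib]
  refine Finset.sum_congr rfl fun i _ => Finset.sum_congr rfl fun j _ => ?_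
  rw [Real.negMulLog]
  ring

theorem trace_mul_cfc_log {X : Matrix A A ℂ} (hX : X.IsHermitian) :
    (X * cfc Real.log X).trace.re = -(entropy X * Real.log 2) := by
  have hlog : Real.log 2 ≠ 0 := (Real.log_pos one_lt_two).ne'
  have h : X * cfc Real.log X = cfc (fun x => x * Real.log x) X := by
    conv_lhs => arg 1; rw [← cfc_id ℝ X hX.isSelfAdjoint]
    exact cfc_mul_matrix _ _
  rw [h, trace_cfc hX, entropy, dif_pos hX, div_mul_cancel₀ _ hlog]
  simp [Real.negMulLog]

end RelativeEntropy

/-! ### Monotonicity of the Holevo quantity and concavity of entropy -/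

section HolevoMonotonicity

open Filter Topology

variable {A B E ι : Type*} [Fintype A] [DecidableEq A] [Fintype B] [DecidableEq B]
  [Fintype E] [DecidableEq E] [Fintype ι]

theorem trace_traceFst (X : Matrix (B × E) (B × E) ℂ) : (traceFst X).trace = X.trace := by
  rw [traceFst, trace_partialTrace, trace_swapFactors]

theorem IsState.traceFst {X : Matrix (B × E) (B × E) ℂ} (hX : IsState X) :
    IsState (traceFst X) :=
  hX.swapFactors.partialTrace

theorem traceFst_apply (X : Matrix (B × E) (B × E) ℂ) (e e' : E) :
    traceFst X e e' = ∑ b, X (b, e) (b, e') :=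
  rfl

theorem traceFst_sum_smul (p : ι → ℂ) (X : ι → Matrix (B × E) (B × E) ℂ) :
    traceFst (∑ i, p i • X i) = ∑ i, p i • traceFst (X i) := by
  ext e e'
  simp only [traceFst_apply, Matrix.sum_apply, Matrix.smul_apply, smul_eq_mul, Finset.mul_sum]
  exact Finset.sum_comm

/-- The mixture of `X` with the maximally mixed state. -/
noncomputable def depolarize (ε : ℝ) (X : Matrix A A ℂ) : Matrix A A ℂ :=
  ((1 - ε : ℝ) : ℂ) • X + ((ε / Fintype.card A : ℝ) : ℂ) • 1

theorem isState_depolarize [Nonempty A] {ε : ℝ} (h0 : 0 ≤ ε) (h1 : ε ≤ 1) {X : Matrix A A ℂ}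
    (hX : IsState X) : IsState (depolarize ε X) := by
  refine ⟨(hX.1.smul ?_).add (Matrix.PosSemidef.one.smul ?_), ?_⟩
  · exact_mod_cast sub_nonneg.2 h1
  · exact_mod_cast (by positivity : 0 ≤ ε / Fintype.card A)
  · have hc : (Fintype.card A : ℂ) ≠ 0 := by exact_mod_cast Fintype.card_ne_zero
    simp [depolarize, hX.2, hc]

theorem posDef_depolarize [Nonempty A] {ε : ℝ} (h0 : 0 < ε) (h1 : ε ≤ 1) {X : Matrix A A ℂ}
    (hX : IsState X) : (depolarize ε X).PosDef := by
  refine Matrix.PosDef.posSemidef_add (hX.1.smul ?_) (Matrix.PosDef.one.smul ?_)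
  · exact_mod_cast sub_nonneg.2 h1
  · have hc : 0 < Fintype.card A := Fintype.card_pos
    exact_mod_cast (by positivity : 0 < ε / Fintype.card A)

/-- Tracing out `B` multiplies the identity by `card B`, which matches the two normalisations of the
maximally mixed state. -/
theorem traceFst_depolarize [Nonempty B] (ε : ℝ) (X : Matrix (B × E) (B × E) ℂ) :
    traceFst (depolarize ε X) = depolarize ε (traceFst X) := by
  have hc : (Fintype.card B : ℂ) ≠ 0 := by exact_mod_cast Fintype.card_ne_zero
  ext e e'
  simp only [traceFst_apply, depolarize, Matrix.add_apply, Matrix.smul_apply, smul_eq_mul,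
    Finset.sum_add_distrib, Finset.mul_sum, Matrix.one_apply, Prod.mk.injEq, true_and,
    Finset.sum_const, Finset.card_univ, nsmul_eq_mul, Fintype.card_prod]
  push_cast
  field_simp

theorem depolarize_sum {p : ι → ℝ} (hp : ∑ i, p i = 1) (ε : ℝ) (X : ι → Matrix A A ℂ) :
    depolarize ε (∑ i, (p i : ℂ) • X i) = ∑ i, (p i : ℂ) • depolarize ε (X i) := by
  have hp' : ∑ i, (p i : ℂ) = 1 := by exact_mod_cast hp
  simp only [depolarize, smul_add, Finset.sum_add_distrib, ← Finset.sum_smul, hp', one_smul,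
    Finset.smul_sum]
  exact congrArg (· + _) (Finset.sum_congr rfl fun i _ => smul_comm _ _ _)

theorem tendsto_entropy_depolarize [Nonempty A] {X : Matrix A A ℂ} (hX : IsState X) :
    Tendsto (fun ε => entropy (depolarize ε X)) (𝓝[>] 0) (𝓝 (entropy X)) := by
  refine (continuousOn_entropy X hX).tendsto.comp (tendsto_nhdsWithin_iff.2 ⟨?_, ?_⟩)
  · have h : Continuous fun ε : ℝ => depolarize ε X := by
      unfold depolarize
      fun_prop
    have h0 : depolarize 0 X = X := by simp [depolarize]
    have := (h.tendsto 0).mono_left (nhdsWithin_le_nhds (s := Set.Ioi 0))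
    rwa [h0] at this
  · filter_upwards [Ioc_mem_nhdsGT one_pos] with ε hε
    exact isState_depolarize hε.1.le hε.2 hX

/-- The cross terms average to `tr Y log Y` for the mean `Y`; the factor `log 2` passes from bits to
nats. -/
theorem holevo_eq_sum_relEntropy {p : ι → ℝ} {X : ι → Matrix A A ℂ} (hX : ∀ i, (X i).IsHermitian)
    (hY : (∑ i, (p i : ℂ) • X i).IsHermitian) :
    (entropy (∑ i, (p i : ℂ) • X i) - ∑ i, p i * entropy (X i)) * Real.log 2 =
      ∑ i, p i * relEntropy (hX i) hY := by
  have h := trace_mul_cfc_log hY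
  rw [Finset.sum_mul, Matrix.trace_sum, Complex.re_sum] at h
  simp only [Matrix.smul_mul, Matrix.trace_smul, smul_eq_mul, Complex.re_ofReal_mul] at h
  simp only [relEntropy_eq, mul_sub, Finset.sum_sub_distrib, h, sub_mul, Finset.sum_mul]
  simp only [mul_neg, Finset.sum_neg_distrib, mul_assoc]
  ring

/-- Monotonicity of the Holevo quantity under partial traces. -/
theorem holevo_traceFst_le [Nonempty B] [Nonempty E] {p : ι → ℝ}
    {X : ι → Matrix (B × E) (B × E) ℂ} (h : IsEnsemble p X) :
    entropy (∑ i, (p i : ℂ) • traceFst (X i)) - ∑ i, p i * entropy (traceFst (X i)) ≤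
      entropy (∑ i, (p i : ℂ) • X i) - ∑ i, p i * entropy (X i) := by
  have hY := IsState.sum h
  have hE : IsEnsemble p fun i => traceFst (X i) :=
    ⟨h.nonneg, h.sum_eq_one, fun i => (h.isState i).traceFst⟩
  have hYE := IsState.sum hE
  -- Relative entropies are compared only for positive definite matrices: depolarise by `ε > 0`,
  -- then let `ε → 0`.
  refine le_of_tendsto_of_tendsto
    ((tendsto_entropy_depolarize hYE).sub (tendsto_finsetSum _ fun i _ =>
      (tendsto_entropy_depolarize (hE.isState i)).const_mul _))
    ((tendsto_entropy_depolarize hY).sub (tendsto_finsetSum _ fun i _ =>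
      (tendsto_entropy_depolarize (h.isState i)).const_mul _)) ?_
  filter_upwards [Ioc_mem_nhdsGT one_pos] with ε hε
  have d1 := fun i => posDef_depolarize hε.1 hε.2 (h.isState i)
  have d2 := posDef_depolarize hε.1 hε.2 hY
  have d3 := fun i => posDef_depolarize hε.1 hε.2 (hE.isState i)
  have d4 := posDef_depolarize hε.1 hε.2 hYE
  rw [depolarize_sum h.sum_eq_one] at d2 d4 ⊢
  rw [depolarize_sum h.sum_eq_one]
  refine le_of_mul_le_mul_right ?_ (Real.log_pos one_lt_two)
  simp only [← traceFst_depolarize] at d3 d4 ⊢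
  rw [holevo_eq_sum_relEntropy (fun i => (d3 i).isHermitian) d4.isHermitian,
    holevo_eq_sum_relEntropy (fun i => (d1 i).isHermitian) d2.isHermitian]
  refine Finset.sum_le_sum fun i _ => mul_le_mul_of_nonneg_left ?_ (h.nonneg i)
  -- The mean of the marginals equals the marginal of the mean only propositionally; a free `Z`
  -- allows the substitution despite the dependence on proofs.
  have key : ∀ (Z : Matrix E E ℂ) (hZ : Z.PosDef),
      Z = traceFst (∑ i, (p i : ℂ) • depolarize ε (X i)) →
      relEntropy (d3 i).isHermitian hZ.isHermitian ≤
        relEntropy (d1 i).isHermitian d2.isHermitian := by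
    rintro _ hZ rfl
    exact relEntropy_traceFst_le (d1 i) d2 (d3 i) hZ
  exact key _ d4 (traceFst_sum_smul _ _).symm

/-- Concavity of the von Neumann entropy. -/
theorem sum_mul_entropy_le [Nonempty A] {p : ι → ℝ} {X : ι → Matrix A A ℂ} (h : IsEnsemble p X) :
    ∑ i, p i * entropy (X i) ≤ entropy (∑ i, (p i : ℂ) • X i) := by
  -- With a trivial second factor the marginals have entropy zero, so Holevo monotonicity says that
  -- the Holevo quantity is nonnegative.
  let f : A × Unit ≃ A := Equiv.prodPUnit A
  have hs : ∀ Y : Matrix A A ℂ, IsState Y → IsState (Y.submatrix f f) := fun Y hY =>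
    ⟨hY.1.submatrix _, by
      rw [← hY.2]
      exact Fintype.sum_equiv f _ _ fun _ => rfl⟩
  have hent : ∀ Y : Matrix A A ℂ, IsState Y → entropy (Y.submatrix f f) = entropy Y := by
    intro Y hY
    rw [entropy_eq_roots hY.isHermitian, entropy_eq_roots (hs Y hY).isHermitian]
    have := Matrix.charpoly_reindex f.symm Y
    rw [Matrix.reindex_apply, Equiv.symm_symm] at this
    rw [this]
  have h' : IsEnsemble p fun i => (X i).submatrix f f :=
    ⟨h.nonneg, h.sum_eq_one, fun i => hs _ (h.isState i)⟩
  have hE : IsEnsemble p fun i => traceFst ((X i).submatrix f f) :=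
    ⟨h.nonneg, h.sum_eq_one, fun i => (h'.isState i).traceFst⟩
  have h1 := holevo_traceFst_le (B := A) (E := Unit) h'
  have h2 : ∑ i, (p i : ℂ) • (X i).submatrix f f = (∑ i, (p i : ℂ) • X i).submatrix f f := by
    ext a a'
    simp [Matrix.sum_apply]
  rw [entropy_of_unique (IsState.sum hE), h2, hent _ (IsState.sum h)] at h1
  simp only [entropy_of_unique (hE.isState _), hent _ (h.isState _)] at h1
  simpa using h1

end HolevoMonotonicity

/-! ### Channels acting on one half of a bipartite state -/

section Channel

variable {A B E : Type*} [Fintype A] [DecidableEq A] [Fintype B] [DecidableEq B]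
  [Fintype E] [DecidableEq E]

theorem tensorId_apply (Ψ : Matrix A A ℂ →ₗ[ℂ] Matrix B B ℂ) (X : Matrix (A × E) (A × E) ℂ)
    (x y : B × E) : tensorId Ψ E X x y =
      Ψ (Matrix.of fun a a' => X (a, x.2) (a', y.2)) x.1 y.1 :=
  rfl

/-- Trace preservation, applied to each block: the reference is not disturbed. -/
theorem traceFst_tensorId {Ψ : Matrix A A ℂ →ₗ[ℂ] Matrix B B ℂ} (hΨ : IsChannel Ψ)
    (X : Matrix (A × E) (A × E) ℂ) : traceFst (tensorId Ψ E X) = traceFst X := by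
  ext e e'
  exact hΨ.tracePreserving (Matrix.of fun a a' => X (a, e) (a', e'))

theorem partialTrace_tensorId (Ψ : Matrix A A ℂ →ₗ[ℂ] Matrix B B ℂ)
    (X : Matrix (A × E) (A × E) ℂ) : partialTrace (tensorId Ψ E X) = Ψ (partialTrace X) := by
  have h : partialTrace X = ∑ e, Matrix.of fun a a' => X (a, e) (a', e) := by
    ext a a'
    simp [partialTrace, Matrix.sum_apply]
  rw [h, map_sum]
  ext x y
  simp [partialTrace, Matrix.sum_apply, tensorId_apply]

theorem IsChannel.isState_tensorId {Ψ : Matrix A A ℂ →ₗ[ℂ] Matrix B B ℂ} (hΨ : IsChannel Ψ)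
    {X : Matrix (A × E) (A × E) ℂ} (hX : IsState X) : IsState (tensorId Ψ E X) :=
  ⟨hΨ.posSemidef_tensorId hX.1, by
    rw [← trace_traceFst, traceFst_tensorId hΨ, trace_traceFst, hX.2]⟩

theorem ketBra_smul (c : ℝ) (ψ : A → ℂ) :
    ketBra ((c : ℂ) • ψ) = ((c ^ 2 : ℝ) : ℂ) • ketBra ψ := by
  ext a a'
  simp only [ketBra, Matrix.vecMulVec_apply, Pi.smul_apply, Pi.star_apply, smul_eq_mul,
    Matrix.smul_apply, star_mul', RCLike.star_def, Complex.conj_ofReal]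
  push_cast
  ring

/-- The zero vector is included, so that measurement outcomes of probability zero also receive a
state. -/
theorem exists_unit_smul_eq [Nonempty A] (v : A → ℂ) :
    ∃ u : A → ℂ, ∑ a, ‖u a‖ ^ 2 = 1 ∧ v = ((√(∑ a, ‖v a‖ ^ 2) : ℝ) : ℂ) • u := by
  set s := ∑ a, ‖v a‖ ^ 2 with hs
  have hs0 : 0 ≤ s := Finset.sum_nonneg fun _ _ => sq_nonneg _
  rcases hs0.eq_or_lt with h | h
  · obtain ⟨a₀⟩ := ‹Nonempty A›
    refine ⟨Pi.single a₀ 1, ?_, ?_⟩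
    · rw [Finset.sum_eq_single a₀] <;> simp +contextual
    · rw [← h, Real.sqrt_zero, Complex.ofReal_zero, zero_smul]
      rw [hs, eq_comm, Finset.sum_eq_zero_iff_of_nonneg fun _ _ => sq_nonneg _] at h
      ext a
      simpa using h a (Finset.mem_univ a)
  · have hq : √s ≠ 0 := (Real.sqrt_pos.2 h).ne'
    have hq' : ((√s : ℝ) : ℂ) ≠ 0 := by exact_mod_cast hq
    refine ⟨((√s : ℝ) : ℂ)⁻¹ • v, ?_, by rw [smul_inv_smul₀ hq']⟩
    simp only [Pi.smul_apply, smul_eq_mul, norm_mul, mul_pow, ← Finset.mul_sum, ← hs, norm_inv,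
      Complex.norm_real, inv_pow, Real.norm_eq_abs, sq_abs, Real.sq_sqrt hs0]
    exact inv_mul_cancel₀ h.ne'

theorem isState_ketBra_purification {ρ : Matrix A A ℂ} (h : IsState ρ) :
    IsState (ketBra (purification ρ)) :=
  ⟨posSemidef_ketBra _, by
    rw [← trace_partialTrace, isPurification_purification h.1, h.2]⟩

/-- Apply `Ψ ⊗ I` to a purification and trace out the reference. -/
theorem IsChannel.isState {Ψ : Matrix A A ℂ →ₗ[ℂ] Matrix B B ℂ} (hΨ : IsChannel Ψ)
    {X : Matrix A A ℂ} (hX : IsState X) : IsState (Ψ X) := by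
  have h := (hΨ.isState_tensorId (isState_ketBra_purification hX)).partialTrace
  rwa [partialTrace_tensorId, isPurification_purification hX.1] at h

theorem nonempty_of_isState {X : Matrix A A ℂ} (hX : IsState X) : Nonempty A := by
  by_contra h
  rw [not_nonempty_iff] at h
  have := hX.2
  simp [Matrix.trace] at this

end Channel

/-! ### Measuring the classical register -/

section ClassicalQuantum

variable {R C B E J : Type*} [Fintype R] [DecidableEq R] [Fintype C] [DecidableEq C]
  [Fintype B] [DecidableEq B] [Fintype E] [DecidableEq E] [Fintype J]

/-- The partial inner product `(⟨j| ⊗ I) ψ`. -/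
noncomputable def basisComponent (b : OrthonormalBasis J ℂ (EuclideanSpace ℂ R)) (j : J)
    (ψ : (R × C) × E → ℂ) : C × E → ℂ :=
  fun x => ∑ r, star (b j r) * ψ ((r, x.1), x.2)

/-- The vector `|j⟩ ⊗ φ`. -/
noncomputable def basisTensor (b : OrthonormalBasis J ℂ (EuclideanSpace ℂ R)) (j : J)
    (φ : C × E → ℂ) : (R × C) × E → ℂ :=
  fun x => b j x.1.1 * φ (x.1.2, x.2)

theorem sum_norm_sq_basis (b : OrthonormalBasis J ℂ (EuclideanSpace ℂ R)) (j : J) :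
    ∑ r, ‖b j r‖ ^ 2 = 1 := by
  rw [← EuclideanSpace.norm_sq_eq, b.orthonormal.1 j, one_pow]

theorem sum_norm_sq_basisTensor (b : OrthonormalBasis J ℂ (EuclideanSpace ℂ R)) (j : J)
    (φ : C × E → ℂ) : ∑ x, ‖basisTensor b j φ x‖ ^ 2 = ∑ x, ‖φ x‖ ^ 2 := by
  have h : ∑ x, ‖basisTensor b j φ x‖ ^ 2 = ∑ r, ∑ c, ∑ e, ‖b j r‖ ^ 2 * ‖φ (c, e)‖ ^ 2 := by
    simp only [basisTensor, Fintype.sum_prod_type, norm_mul, mul_pow]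
  rw [h]
  simp only [← Finset.mul_sum, ← Finset.sum_mul, sum_norm_sq_basis, one_mul,
    Fintype.sum_prod_type]

theorem basisTensor_smul (b : OrthonormalBasis J ℂ (EuclideanSpace ℂ R)) (j : J) (c : ℂ)
    (φ : C × E → ℂ) : basisTensor b j (c • φ) = c • basisTensor b j φ := by
  ext x
  simp only [basisTensor, Pi.smul_apply, smul_eq_mul]
  ring

theorem isPurification_basisTensor (b : OrthonormalBasis J ℂ (EuclideanSpace ℂ R)) (j : J)
    (φ : C × E → ℂ) :
    IsPurification (basisTensor b j φ) (basisProj b j ⊗ₖ partialTrace (ketBra φ)) := by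
  ext x y
  simp only [partialTrace, ketBra, basisTensor, basisProj, Matrix.of_apply,
    Matrix.vecMulVec_apply, Matrix.kroneckerMap_apply, Pi.star_apply, star_mul', Finset.mul_sum]
  exact Finset.sum_congr rfl fun _ _ => by ring

/-- Stated for a single block, because `tensorId Ψ E` feeds `Ψ` one such block at a time. -/
theorem tensorId_dephasing_ketBra (b : OrthonormalBasis J ℂ (EuclideanSpace ℂ R))
    (ψ : (R × C) × E → ℂ) (e e' : E) :
    tensorId (dephasing b) C (Matrix.of fun a a' => ketBra ψ (a, e) (a', e')) =
      ∑ j, Matrix.of fun a a' =>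
        ketBra (basisTensor b j (basisComponent b j ψ)) (a, e) (a', e') := by
  ext x y
  simp only [tensorId_apply, dephasing, LinearMap.coe_mk, AddHom.coe_mk, Matrix.sum_apply,
    Matrix.of_apply, Matrix.mul_apply, basisProj, ketBra, Matrix.vecMulVec_apply, basisTensor,
    basisComponent, Pi.star_apply, star_mul', star_sum, star_star, Finset.sum_mul, Finset.mul_sum]
  exact Finset.sum_congr rfl fun j _ => Finset.sum_congr rfl fun r _ =>
    Finset.sum_congr rfl fun r' _ => by ring

theorem tensorId_ketBra_eq_sum {Ψ : Matrix (R × C) (R × C) ℂ →ₗ[ℂ] Matrix B B ℂ}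
    {b : OrthonormalBasis J ℂ (EuclideanSpace ℂ R)} (hb : Ψ = Ψ ∘ₗ tensorId (dephasing b) C)
    (ψ : (R × C) × E → ℂ) : tensorId Ψ E (ketBra ψ) =
      ∑ j, tensorId Ψ E (ketBra (basisTensor b j (basisComponent b j ψ))) := by
  ext x y
  rw [tensorId_apply, hb, LinearMap.comp_apply, tensorId_dephasing_ketBra, map_sum, ← hb]
  simp only [Matrix.sum_apply, tensorId_apply]

/-- Measuring the classical register of a state does not increase the average entropy, and does
not decrease the difference between the entropies of the input and of the joint output. -/
theorem exists_cqState_decomposition [Nonempty R] [Nonempty C]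
    {Ψ : Matrix (R × C) (R × C) ℂ →ₗ[ℂ] Matrix B B ℂ} (hΨ : IsChannel Ψ)
    {b : OrthonormalBasis J ℂ (EuclideanSpace ℂ R)} (hb : Ψ = Ψ ∘ₗ tensorId (dephasing b) C)
    {σ : Matrix (R × C) (R × C) ℂ} (hσ : IsState σ) :
    ∃ (p : J → ℝ) (ρ : J → Matrix C C ℂ), IsEnsemble p ρ ∧
      (∀ j, IsState (basisProj b j ⊗ₖ ρ j)) ∧
      ∑ j, (p j : ℂ) • Ψ (basisProj b j ⊗ₖ ρ j) = Ψ σ ∧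
      ∑ j, p j * entropy (basisProj b j ⊗ₖ ρ j) ≤ entropy σ ∧
      entropy σ - entropy (tensorId Ψ (R × C) (ketBra (purification σ))) ≤
        ∑ j, p j * entropy (basisProj b j ⊗ₖ ρ j) -
        ∑ j, p j * entropy (tensorId Ψ (R × C)
          (ketBra (purification (basisProj b j ⊗ₖ ρ j)))) := by
  set ψ := purification σ with hψ
  have hψs : IsState (ketBra ψ) := isState_ketBra_purification hσ
  have hψσ : partialTrace (ketBra ψ) = σ := isPurification_purification hσ.1
  have hω := hΨ.isState_tensorId hψs
  have hB : Nonempty B := nonempty_of_isState hω.partialTrace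
  -- Post-measurement vectors `φ j`; the squared norms `p j` of the components are the outcome
  -- probabilities.
  choose φ hφ1 hφ using fun j => exists_unit_smul_eq (basisComponent b j ψ)
  set p : J → ℝ := fun j => ∑ x, ‖basisComponent b j ψ x‖ ^ 2 with hp
  have hp0 : ∀ j, 0 ≤ p j := fun j => Finset.sum_nonneg fun _ _ => sq_nonneg _
  let v : J → (R × C) × (R × C) → ℂ := fun j => basisTensor b j (φ j)
  have hv : ∀ j, IsState (ketBra (v j)) := fun j =>
    IsState.ketBra (by rw [sum_norm_sq_basisTensor, hφ1])
  let ρ : J → Matrix C C ℂ := fun j => partialTrace (ketBra (φ j))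
  have hpur : ∀ j, partialTrace (ketBra (v j)) = basisProj b j ⊗ₖ ρ j := fun j =>
    isPurification_basisTensor b j (φ j)
  have hcq : ∀ j, IsState (basisProj b j ⊗ₖ ρ j) := fun j => by
    rw [← hpur]
    exact (hv j).partialTrace
  have hdec : tensorId Ψ (R × C) (ketBra ψ) =
      ∑ j, (p j : ℂ) • tensorId Ψ (R × C) (ketBra (v j)) := by
    rw [tensorId_ketBra_eq_sum hb]
    refine Finset.sum_congr rfl fun j _ => ?_
    rw [hφ j, basisTensor_smul, ketBra_smul, Real.sq_sqrt (hp0 j), map_smul]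
  have hens : IsEnsemble p fun j => tensorId Ψ (R × C) (ketBra (v j)) := by
    refine ⟨hp0, ?_, fun j => hΨ.isState_tensorId (hv j)⟩
    have h := hω.2
    rw [hdec, Matrix.trace_sum] at h
    simp only [Matrix.trace_smul, (hΨ.isState_tensorId (hv _)).2, smul_eq_mul, mul_one] at h
    exact_mod_cast h
  have hens' : IsEnsemble p fun j => traceFst (tensorId Ψ (R × C) (ketBra (v j))) :=
    ⟨hp0, hens.sum_eq_one, fun j => (hens.isState j).traceFst⟩
  have hmarg : ∀ j, entropy (traceFst (tensorId Ψ (R × C) (ketBra (v j)))) =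
      entropy (basisProj b j ⊗ₖ ρ j) := fun j => by
    rw [traceFst_tensorId hΨ, ← hpur]
    exact entropy_partialTrace_swapFactors_ketBra (v j)
  have hσE : entropy (∑ j, (p j : ℂ) • traceFst (tensorId Ψ (R × C) (ketBra (v j)))) =
      entropy σ := by
    rw [← traceFst_sum_smul, ← hdec, traceFst_tensorId hΨ]
    conv_rhs => rw [← hψσ]
    exact entropy_partialTrace_swapFactors_ketBra ψ
  -- `v j` need not be the canonical purification used by `chiAssist`, but the output entropy is the
  -- same.
  have hout : ∀ j, entropy (tensorId Ψ (R × C) (ketBra (v j))) =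
      entropy (tensorId Ψ (R × C) (ketBra (purification (basisProj b j ⊗ₖ ρ j)))) := fun j =>
    entropy_tensorId_purification hΨ (hcq j).1 (hpur j)
  refine ⟨p, ρ, ⟨hp0, hens.sum_eq_one, fun j => (IsState.ketBra (hφ1 j)).partialTrace⟩, hcq,
    ?_, ?_, ?_⟩
  · have h := congrArg partialTrace hdec
    rw [partialTrace_tensorId, hψσ] at h
    rw [h]
    ext x y
    simp only [← hpur, ← partialTrace_tensorId]
    simp only [partialTrace, Matrix.of_apply, Matrix.sum_apply, Matrix.smul_apply, smul_eq_mul,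
      Finset.mul_sum]
    exact Finset.sum_comm
  -- Concavity on the reference system, whose mean state has entropy `S(σ)`.
  · have h := sum_mul_entropy_le hens'
    rwa [hσE, Finset.sum_congr rfl fun j _ => by rw [hmarg j]] at h
  -- Discarding `B` cannot increase the Holevo quantity; rearranged, this is the claim.
  · have h := holevo_traceFst_le hens
    rw [hσE, ← hdec] at h
    simp only [hmarg, hout] at h
    linarith

/-- Every ensemble is dominated by one with a classical register. -/
theorem exists_cqEnsemble_ge [Nonempty R] [Nonempty C]
    {Ψ : Matrix (R × C) (R × C) ℂ →ₗ[ℂ] Matrix B B ℂ} (hΨ : IsChannel Ψ)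
    {b : OrthonormalBasis J ℂ (EuclideanSpace ℂ R)} (hb : Ψ = Ψ ∘ₗ tensorId (dephasing b) C)
    {ι : Type*} [Fintype ι] {q : ι → ℝ} {σ : ι → Matrix (R × C) (R × C) ℂ}
    (h : IsEnsemble q σ) :
    ∃ (p : ι × J → ℝ) (ρ : ι × J → Matrix C C ℂ), IsEnsemble p ρ ∧
      IsEnsemble p (cqStates b ρ) ∧
      entanglementCost p (cqStates b ρ) ≤ entanglementCost q σ ∧
      chiAssist Ψ q σ ≤ chiAssist Ψ p (cqStates b ρ) := by
  choose p ρ h1 h2 h3 h4 h5 using fun i => exists_cqState_decomposition hΨ hb (h.isState i)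
  have hp0 : ∀ x : ι × J, 0 ≤ q x.1 * p x.1 x.2 := fun x =>
    mul_nonneg (h.nonneg _) ((h1 _).nonneg _)
  have hp1 : ∑ x : ι × J, q x.1 * p x.1 x.2 = 1 := by
    simp only [Fintype.sum_prod_type, ← Finset.mul_sum, (h1 _).sum_eq_one, mul_one, h.sum_eq_one]
  have hsum : ∀ f : ι × J → ℝ, ∑ x : ι × J, q x.1 * p x.1 x.2 * f x =
      ∑ i, q i * ∑ j, p i j * f (i, j) := fun f => by
    simp only [Fintype.sum_prod_type, Finset.mul_sum, mul_assoc]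
  have hcost : ∑ x : ι × J, q x.1 * p x.1 x.2 * entropy (basisProj b x.2 ⊗ₖ ρ x.1 x.2) ≤
      ∑ i, q i * entropy (σ i) := by
    rw [hsum]
    exact Finset.sum_le_sum fun i _ => mul_le_mul_of_nonneg_left (h4 i) (h.nonneg i)
  refine ⟨fun x => q x.1 * p x.1 x.2, fun x => ρ x.1 x.2,
    ⟨hp0, hp1, fun x => (h1 _).isState _⟩, ⟨hp0, hp1, fun x => h2 _ _⟩, hcost, ?_⟩
  have hout : Ψ (∑ x : ι × J, ((q x.1 * p x.1 x.2 : ℝ) : ℂ) • (basisProj b x.2 ⊗ₖ ρ x.1 x.2)) =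
      Ψ (∑ i, (q i : ℂ) • σ i) := by
    simp only [map_sum, map_smul, Fintype.sum_prod_type, Complex.ofReal_mul, mul_smul,
      ← Finset.smul_sum, h3]
  have h6 : ∑ i, q i * (entropy (σ i) -
      entropy (tensorId Ψ (R × C) (ketBra (purification (σ i))))) ≤
      ∑ i, q i * (∑ j, p i j * entropy (basisProj b j ⊗ₖ ρ i j) -
        ∑ j, p i j * entropy (tensorId Ψ (R × C)
          (ketBra (purification (basisProj b j ⊗ₖ ρ i j))))) :=
    Finset.sum_le_sum fun i _ => mul_le_mul_of_nonneg_left (h5 i) (h.nonneg i)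
  unfold chiAssist cqStates
  rw [hout, hsum, hsum fun x => entropy (tensorId Ψ (R × C)
    (ketBra (purification (basisProj b x.2 ⊗ₖ ρ x.1 x.2))))]
  simp only [mul_sub, Finset.sum_sub_distrib] at h6
  linarith

end ClassicalQuantum

/-! ### Compactness and existence of the maximum -/

section Attainment

/-- By Carathéodory, `finrank + 1` points suffice, so the hull is a continuous image of a simplex
times a power of `s`. -/
theorem isCompact_convexHull_of_finiteDimensional {V : Type*} [AddCommGroup V] [Module ℝ V]
    [FiniteDimensional ℝ V] [TopologicalSpace V] [ContinuousAdd V] [ContinuousSMul ℝ V]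
    {s : Set V} (hs : IsCompact s) : IsCompact (convexHull ℝ s) := by
  rcases s.eq_empty_or_nonempty with rfl | ⟨z₀, hz₀⟩
  · simp
  let N := Module.finrank ℝ V + 1
  let f : (Fin N → ℝ) × (Fin N → V) → V := fun x => ∑ i, x.1 i • x.2 i
  have hf : Continuous f := by
    unfold f
    fun_prop
  convert ((isCompact_stdSimplex ℝ (Fin N)).prod (isCompact_univ_pi fun _ : Fin N => hs)).image hf
    using 1
  ext x
  constructor
  · intro hx
    obtain ⟨ι, _, z, w, hz, hind, hw, hw1, rfl⟩ := eq_pos_convex_span_of_mem_convexHull hx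
    have hcard : Fintype.card ι ≤ Fintype.card (Fin N) := by
      rw [Fintype.card_fin]
      exact hind.card_le_finrank_succ.trans (Nat.succ_le_succ (Submodule.finrank_le _))
    obtain ⟨e⟩ := Function.Embedding.nonempty_of_card_le hcard
    have hw' : ∀ i ∉ Set.range e, Function.extend e w 0 i = 0 := fun i hi =>
      Function.extend_apply' _ _ _ hi
    -- Unused slots get weight zero and the dummy point `z₀`.
    refine ⟨(Function.extend e w 0, Function.extend e z fun _ => z₀), ⟨⟨fun i => ?_, ?_⟩, ?_⟩, ?_⟩
      <;> dsimp only [f]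
    · by_cases hi : i ∈ Set.range e
      · obtain ⟨k, rfl⟩ := hi
        rw [e.injective.extend_apply]
        exact (hw k).le
      · rw [hw' i hi]
    · rw [← hw1]
      exact (Fintype.sum_of_injective e e.injective _ _ hw' fun i =>
        (e.injective.extend_apply _ _ _).symm).symm
    · intro i _
      dsimp only
      by_cases hi : i ∈ Set.range e
      · obtain ⟨k, rfl⟩ := hi
        rw [e.injective.extend_apply]
        exact hz ⟨k, rfl⟩
      · rw [Function.extend_apply' _ _ _ hi]
        exact hz₀
    · refine (Fintype.sum_of_injective e e.injective _ _ (fun i hi => ?_) fun i => ?_).symm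
      · rw [hw' i hi, zero_smul]
      · rw [e.injective.extend_apply, e.injective.extend_apply]
  · rintro ⟨⟨w, z⟩, ⟨hw, hz⟩, rfl⟩
    exact mem_convexHull_of_exists_fintype w z hw.1 hw.2 (fun i => hz i (Set.mem_univ i)) rfl

variable {A B ι : Type*} [Fintype A] [DecidableEq A] [Fintype B] [DecidableEq B] [Fintype ι]

/-- A state together with its entropy and the entropy of the joint output for its purification. -/
noncomputable def entropyGraph (Ψ : Matrix A A ℂ →ₗ[ℂ] Matrix B B ℂ) (ρ : Matrix A A ℂ) :
    Matrix A A ℂ × ℝ × ℝ :=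
  (ρ, entropy ρ, entropy (tensorId Ψ A (ketBra (purification ρ))))

/-- The convex hull of the entropy graph over all states. -/
noncomputable def ensembleHull (Ψ : Matrix A A ℂ →ₗ[ℂ] Matrix B B ℂ) :
    Set (Matrix A A ℂ × ℝ × ℝ) :=
  convexHull ℝ (entropyGraph Ψ '' {ρ | IsState ρ})

theorem sum_smul_entropyGraph (Ψ : Matrix A A ℂ →ₗ[ℂ] Matrix B B ℂ) (p : ι → ℝ)
    (ρ : ι → Matrix A A ℂ) : ∑ i, p i • entropyGraph Ψ (ρ i) =
      (∑ i, (p i : ℂ) • ρ i, entanglementCost p ρ,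
        ∑ i, p i * entropy (tensorId Ψ A (ketBra (purification (ρ i))))) := by
  refine Prod.ext ?_ (Prod.ext ?_ ?_) <;>
    simp [Prod.fst_sum, Prod.snd_sum, entropyGraph, entanglementCost]

theorem sum_smul_entropyGraph_mem (Ψ : Matrix A A ℂ →ₗ[ℂ] Matrix B B ℂ) {p : ι → ℝ}
    {ρ : ι → Matrix A A ℂ} (h : IsEnsemble p ρ) :
    ∑ i, p i • entropyGraph Ψ (ρ i) ∈ ensembleHull Ψ :=
  mem_convexHull_of_exists_fintype p _ h.nonneg h.sum_eq_one
    (fun i => ⟨ρ i, h.isState i, rfl⟩) rfl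

theorem exists_ensemble_of_mem_ensembleHull {Ψ : Matrix A A ℂ →ₗ[ℂ] Matrix B B ℂ}
    {v : Matrix A A ℂ × ℝ × ℝ} (hv : v ∈ ensembleHull Ψ) :
    ∃ (n : ℕ) (p : Fin n → ℝ) (ρ : Fin n → Matrix A A ℂ), IsEnsemble p ρ ∧
      ∑ i, p i • entropyGraph Ψ (ρ i) = v := by
  obtain ⟨ι, _, w, z, hw, hw1, hz, rfl⟩ := mem_convexHull_iff_exists_fintype.1 hv
  choose ρ hρ hρz using hz
  let e := (Fintype.equivFin ι).symm
  refine ⟨_, w ∘ e, ρ ∘ e, ⟨fun i => hw _, ?_, fun i => hρ _⟩, ?_⟩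
  · rw [← hw1]
    exact e.sum_comp w
  · rw [← e.sum_comp]
    simp only [Function.comp_apply, hρz]

/-- The value of `chiAssist` as a function on the hull of the entropy graph. -/
noncomputable def hullValue (Ψ : Matrix A A ℂ →ₗ[ℂ] Matrix B B ℂ)
    (v : Matrix A A ℂ × ℝ × ℝ) : ℝ :=
  v.2.1 + entropy (Ψ v.1) - v.2.2

theorem hullValue_sum (Ψ : Matrix A A ℂ →ₗ[ℂ] Matrix B B ℂ) (p : ι → ℝ)
    (ρ : ι → Matrix A A ℂ) :
    hullValue Ψ (∑ i, p i • entropyGraph Ψ (ρ i)) = chiAssist Ψ p ρ := by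
  rw [sum_smul_entropyGraph]
  rfl

/-- Ensembles of unbounded size are replaced by points of one finite-dimensional convex hull. -/
theorem achievable_eq_image (Ψ : Matrix A A ℂ →ₗ[ℂ] Matrix B B ℂ) (P : ℝ) :
    achievable Ψ P = hullValue Ψ '' (ensembleHull Ψ ∩ {v | v.2.1 ≤ P}) := by
  ext x
  constructor
  · rintro ⟨n, p, ρ, h, hP, rfl⟩
    refine ⟨_, ⟨sum_smul_entropyGraph_mem Ψ h, ?_⟩, hullValue_sum Ψ p ρ⟩
    rwa [Set.mem_ofPred_eq, sum_smul_entropyGraph]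
  · rintro ⟨v, ⟨hv, hP⟩, rfl⟩
    obtain ⟨n, p, ρ, h, rfl⟩ := exists_ensemble_of_mem_ensembleHull hv
    rw [Set.mem_ofPred_eq, sum_smul_entropyGraph] at hP
    exact ⟨n, p, ρ, h, hP, (hullValue_sum Ψ p ρ).symm⟩

theorem chiAssist_mem_achievable {Ψ : Matrix A A ℂ →ₗ[ℂ] Matrix B B ℂ} {P : ℝ} {p : ι → ℝ}
    {ρ : ι → Matrix A A ℂ} (h : IsEnsemble p ρ) (hP : entanglementCost p ρ ≤ P) :
    chiAssist Ψ p ρ ∈ achievable Ψ P := by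
  rw [achievable_eq_image]
  refine ⟨_, ⟨sum_smul_entropyGraph_mem Ψ h, ?_⟩, hullValue_sum Ψ p ρ⟩
  rwa [Set.mem_ofPred_eq, sum_smul_entropyGraph]

theorem continuousOn_entropyGraph {Ψ : Matrix A A ℂ →ₗ[ℂ] Matrix B B ℂ} (hΨ : IsChannel Ψ) :
    ContinuousOn (entropyGraph Ψ) {ρ | IsState ρ} := by
  have h1 : ContinuousOn (fun ρ : Matrix A A ℂ => ketBra (purification ρ)) {ρ | IsState ρ} := by
    have h : Continuous fun M : Matrix A A ℂ => ketBra fun x : A × A => M x.1 x.2 := by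
      refine continuous_matrix fun x y => ?_
      simp only [ketBra, Matrix.vecMulVec_apply, Pi.star_apply]
      fun_prop
    exact h.comp_continuousOn (continuousOn_cfc_state Real.continuous_sqrt)
  have h2 : Continuous (tensorId Ψ A) := LinearMap.continuous_of_finiteDimensional _
  have h3 := continuousOn_entropy.comp (h2.comp_continuousOn h1) fun ρ (hρ : IsState ρ) =>
    hΨ.isState_tensorId (isState_ketBra_purification hρ)
  exact continuousOn_id.prodMk (continuousOn_entropy.prodMk h3)

theorem isCompact_achievable {Ψ : Matrix A A ℂ →ₗ[ℂ] Matrix B B ℂ} (hΨ : IsChannel Ψ) (P : ℝ) :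
    IsCompact (achievable Ψ P) := by
  rw [achievable_eq_image]
  have hK : IsCompact (ensembleHull Ψ) := isCompact_convexHull_of_finiteDimensional
    (isCompact_setOf_isState.image_of_continuousOn (continuousOn_entropyGraph hΨ))
  have hc : IsClosed {v : Matrix A A ℂ × ℝ × ℝ | v.2.1 ≤ P} :=
    isClosed_le (by fun_prop) continuous_const
  refine (hK.inter_right hc).image_of_continuousOn
    (ContinuousOn.mono (s := ensembleHull Ψ) ?_ Set.inter_subset_left)
  have h1 : Continuous Ψ := LinearMap.continuous_of_finiteDimensional _
  have h2 : ContinuousOn (fun v : Matrix A A ℂ × ℝ × ℝ => entropy (Ψ v.1)) (ensembleHull Ψ) := by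
    -- Continuity of the entropy is available only on states, so `Ψ v.1` must be shown to be one.
    refine continuousOn_entropy.comp (h1.comp continuous_fst).continuousOn fun v hv => ?_
    obtain ⟨n, p, ρ, h, rfl⟩ := exists_ensemble_of_mem_ensembleHull hv
    rw [sum_smul_entropyGraph]
    exact hΨ.isState (IsState.sum h)
  have h3 : Continuous fun v : Matrix A A ℂ × ℝ × ℝ => v.2.1 := by fun_prop
  have h4 : Continuous fun v : Matrix A A ℂ × ℝ × ℝ => v.2.2 := by fun_prop
  exact (h3.continuousOn.add h2).sub h4.continuousOn

theorem entropy_ketBra {ψ : A → ℂ} (h : ∑ a, ‖ψ a‖ ^ 2 = 1) : entropy (ketBra ψ) = 0 := by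
  let u : Matrix A Unit ℂ := Matrix.of fun a _ => ψ a
  have h1 : ketBra ψ = u * u.conjTranspose := by
    ext a a'
    simp [ketBra, Matrix.vecMulVec_apply, Matrix.mul_apply, u]
  have h2 : IsState (u.conjTranspose * u) := by
    refine ⟨Matrix.posSemidef_conjTranspose_mul_self u, ?_⟩
    rw [Matrix.trace_mul_comm, ← h1, trace_ketBra, h, Complex.ofReal_one]
  rw [entropy_mul_comm (IsState.ketBra h).isHermitian h2.isHermitian _ _ h1 rfl,
    entropy_of_unique h2]

/-- A single pure state has zero entropy and so respects every budget `P ≥ 0`. -/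
theorem nonempty_achievable [Nonempty A] (Ψ : Matrix A A ℂ →ₗ[ℂ] Matrix B B ℂ) {P : ℝ}
    (hP : 0 ≤ P) : (achievable Ψ P).Nonempty := by
  obtain ⟨u, hu, -⟩ := exists_unit_smul_eq (0 : A → ℂ)
  refine ⟨_, chiAssist_mem_achievable (ι := Unit) (p := fun _ => 1) (ρ := fun _ => ketBra u)
    ⟨fun _ => zero_le_one, by simp, fun _ => IsState.ketBra hu⟩ ?_⟩
  simpa [entanglementCost, entropy_ketBra hu] using hP

theorem isGreatest_capacity [Nonempty A] {Ψ : Matrix A A ℂ →ₗ[ℂ] Matrix B B ℂ}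
    (hΨ : IsChannel Ψ) {P : ℝ} (hP : 0 ≤ P) :
    IsGreatest (achievable Ψ P) (capacity Ψ P) :=
  (isCompact_achievable hΨ P).isGreatest_sSup (nonempty_achievable Ψ hP)

end Attainment

end LimitedEA

theorem lemma1 {R C B J : Type*}
    [Fintype R] [DecidableEq R] [Nonempty R] [Fintype C] [DecidableEq C] [Nonempty C]
    [Fintype B] [DecidableEq B] [Fintype J]
    (Ψ : Matrix (R × C) (R × C) ℂ →ₗ[ℂ] Matrix B B ℂ) (hΨ : LimitedEA.IsChannel Ψ)
    (b : OrthonormalBasis J ℂ (EuclideanSpace ℂ R))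
    (hb : Ψ = Ψ ∘ₗ LimitedEA.tensorId (LimitedEA.dephasing b) C) :
    (∀ P : ℝ, 0 ≤ P →
      IsGreatest (LimitedEA.achievable Ψ P) (LimitedEA.capacity Ψ P) ∧
      ∃ (m : ℕ) (p : Fin m × J → ℝ) (ρ : Fin m × J → Matrix C C ℂ),
        LimitedEA.IsEnsemble p ρ ∧
        LimitedEA.IsEnsemble p (LimitedEA.cqStates b ρ) ∧
        LimitedEA.entanglementCost p (LimitedEA.cqStates b ρ) ≤ P ∧
        LimitedEA.chiAssist Ψ p (LimitedEA.cqStates b ρ) = LimitedEA.capacity Ψ P) ∧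
    (∀ (n : ℕ) (q : Fin n → ℝ) (σ : Fin n → Matrix (R × C) (R × C) ℂ),
      LimitedEA.IsEnsemble q σ →
      ∃ (m : ℕ) (p : Fin m × J → ℝ) (ρ : Fin m × J → Matrix C C ℂ),
        LimitedEA.IsEnsemble p ρ ∧
        LimitedEA.IsEnsemble p (LimitedEA.cqStates b ρ) ∧
        LimitedEA.entanglementCost p (LimitedEA.cqStates b ρ) ≤
          LimitedEA.entanglementCost q σ ∧
        LimitedEA.chiAssist Ψ q σ ≤ LimitedEA.chiAssist Ψ p (LimitedEA.cqStates b ρ)) := by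
  refine ⟨fun P hP => ?_, fun n q σ h => ⟨n, LimitedEA.exists_cqEnsemble_ge hΨ hb h⟩⟩
  have hmax := LimitedEA.isGreatest_capacity hΨ hP
  refine ⟨hmax, ?_⟩
  obtain ⟨n, q, σ, h, hcost, hchi⟩ := hmax.1
  -- A maximiser is dominated by a classical-quantum ensemble within the same budget, which is
  -- therefore a maximiser too.
  obtain ⟨p, ρ, h1, h2, h3, h4⟩ := LimitedEA.exists_cqEnsemble_ge hΨ hb h
  refine ⟨n, p, ρ, h1, h2, h3.trans hcost, le_antisymm ?_ (hchi ▸ h4)⟩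
  exact hmax.2 (LimitedEA.chiAssist_mem_achievable h2 (h3.trans hcost))
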